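/- **Setting.** Let $\gamma>1$. For $\mathbf U=(\rho,\mathbf m,E)\in\mathbb R\times\mathbb R^2\times\mathbb R$ put $\mathbf u=\mathbf m/\rho$, $e=\frac1\rho\big(E-\frac{\|\mathbf m\|^2}{2\rho}\big)$, $p=(\gamma-1)\rho e$, and let $G=\{\mathbf U:\rho>0,\ E-\frac{\|\mathbf m\|^2}{2\rho}>0\}$. Let $\mathbf F(\mathbf U)=(\rho\mathbf u,\ \rho\mathbf u\otimes\mathbf u+p\mathbf I,\ (E+p)\mathbf u)$. For a unit vector $\mathbf n$ let $\alpha_{\mathbf n}(\mathbf U)=|\mathbf u\cdot\mathbf n|+\sqrt{\gamma p/\rho}$, and let $\mathbf F^{hllc}(\mathbf U_L,\mathbf U_R;\mathbf n)$ be the two-dimensional HLLC flux with signal speeds $$S_L=\min_{\mathbf U\in\{\mathbf U_L,\mathbf U_R\}}\big(\mathbf u\cdot\mathbf n-\sqrt{\gamma p/\rho}\big),\qquad S_R=\max_{\mathbf U\in\{\mathbf U_L,\mathbf U_R\}}\big(\mathbf u\cdot\mathbf n+\sqrt{\gamma p/\rho}\big).$$ Let $\mathcal T_h$ be a partition of a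 domain $\Omega\subset\mathbb R^2$ into closed polygons $K$ of area $|K|$ (possibly unstructured; any two distinct edges meet at most in end points). For an edge $\mathscr E$ of $K$ let $|\mathscr E|$ be its length and $\mathbf n_{\mathscr E,K}$ the outward unit normal. Let $k\ge 0$, $N=k+1$, and let $\mathbb V_h^k$ be the space of functions that are, on each cell, polynomials of total degree at most $k$. Cell averages over $K$ are written $\overline{(\cdot)}_K$. Let $\mathbf x_{\mathscr E}^{(\mu)},\omega_\mu$ ($1\le\mu\le N$) be the $N$-point Gauss nodes and normalized weights on $\mathscr E$. On each $K$ let $\mathbf x_K^{(q)}\in K$, $\varpi_q\ge0$ ($1\le q\le Q$) be a quadrature with normalized weights that is exact for polynomials of degree at most $k$. Let $\rho^e_h,p^e_h\in\mathbb V_h^k$ be projections of $\rho^e,p^e$, where $\nabla p^e=-\rho^e\nabla\phi$ in $\Omega$, and let $\mathbf U_h=(\rho_h,\mathbf m_h,E_h)$ have all its components in $\mathbb V_h^k$. On the edges of $K$, "int" denotes the trace from $K$ and "ext" the trace from the cell on the other side. On boundary edges the exterior values of $\mathbf U_h$ and $p_h^e$ at the Gauss points are prescribed (boundary data), with the former in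 $G$ and the latter positive. A pair of subscripts $\mathscr E,\mu$ means evaluation at $\mathbf x_{\mathscr E}^{(\mu)}$. Put $$p^{e,\star}_{\mathscr E,\mu}=\tfrac12\big(p^{e,\rm int}_{\mathscr E,\mu}+p^{e,\rm ext}_{\mathscr E,\mu}\big),\qquad [\![p_h^e]\!]_{\mathscr E,\mu}=p^{e,\rm ext}_{\mathscr E,\mu}-p^{e,\rm int}_{\mathscr E,\mu},$$ $$\widehat{\mathbf F}_{\mathscr E,\mu}=\mathbf F^{hllc}\Big(\tfrac{p^{e,\star}_{\mathscr E,\mu}}{p^{e,\rm int}_{\mathscr E,\mu}}\mathbf U^{\rm int}_{\mathscr E,\mu},\tfrac{p^{e,\star}_{\mathscr E,\mu}}{p^{e,\rm ext}_{\mathscr E,\mu}}\mathbf U^{\rm ext}_{\mathscr E,\mu};\mathbf n_{\mathscr E,K}\Big).$$ The well-balanced DG scheme is, for all test polynomials $v$ of degree at most $k$ on $K$, $$\int_K(\mathbf U_h)_t v\,d\mathbf x=|K|\sum_q\varpi_q\mathbf F(\mathbf U_h(\mathbf x_K^{(q)}))\cdot\nabla v(\mathbf x_K^{(q)})+\big(0,\langle\mathbf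 S^{[2]},v\rangle_K,\langle S^{[3]},v\rangle_K\big)-\sum_{\mathscr E\subset\partial K}|\mathscr E|\sum_\mu\omega_\mu\widehat{\mathbf F}_{\mathscr E,\mu}\,v(\mathbf x_{\mathscr E}^{(\mu)}).$$ Here, with $\mathbf B_K(v)=\sum_{\mathscr E}|\mathscr E|\sum_\mu\omega_\mu p^{e,\star}_{\mathscr E,\mu}v(\mathbf x_{\mathscr E}^{(\mu)})\mathbf n_{\mathscr E,K}-|K|\sum_q\varpi_q p_h^e(\mathbf x_K^{(q)})\nabla v(\mathbf x_K^{(q)})$, $$\langle\mathbf S^{[2]},v\rangle_K=|K|\sum_q\varpi_q\Big(\frac{\rho_h}{\rho_h^e}(\mathbf x_K^{(q)})-\frac{\overline{(\rho_h)}_K}{\overline{(\rho_h^e)}_K}\Big)(\nabla p_h^e\,v)(\mathbf x_K^{(q)})+\frac{\overline{(\rho_h)}_K}{\overline{(\rho_h^e)}_K}\mathbf B_K(v),$$ $$\langle S^{[3]},v\rangle_K=|K|\sum_q\varpi_q\Big(\frac{\mathbf m_h}{\rho_h^e}(\mathbf x_K^{(q)})-\frac{\overline{(\mathbf m_h)}_K}{\overline{(\rho_h^e)}_K}\Big)\cdot(\nabla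 p_h^e\,v)(\mathbf x_K^{(q)})+\frac{\overline{(\mathbf m_h)}_K}{\overline{(\rho_h^e)}_K}\cdot\mathbf B_K(v).$$ Let $\mathbf L_K(\mathbf U_h)$ be $\frac1{|K|}$ times the right-hand side of the scheme with $v=1$, so that $\frac{d}{dt}\overline{\mathbf U}_K=\mathbf L_K(\mathbf U_h)$. Suppose that on each cell $K$ there is a quadrature with positive weights $$\frac1{|K|}\int_K u\,d\mathbf x=\sum_{\mathscr E\subset\partial K}\sum_{\mu=1}^N\widehat\varpi_{\mathscr E}^{(\mu)}u(\mathbf x_{\mathscr E}^{(\mu)})+\sum_{q=1}^{\widetilde Q}\widetilde\varpi_q u(\widetilde{\mathbf x}_K^{(q)}),\qquad \widetilde{\mathbf x}_K^{(q)}\in K,$$ that is exact for all polynomials $u$ of degree at most $k$. Put $\mathbb S_K=\{\mathbf x_{\mathscr E}^{(\mu)}\}\cup\{\widetilde{\mathbf x}_K^{(q)}\}\cup\{\mathbf x_K^{(q)}\}$. **Theorem.** Assume that for all $K\in\mathcal T_h$ and $\mathbf x\in\mathbb S_K$ (values taken from $K$) one has $\rho_h^e(\mathbf x)>0$, $p_h^e(\mathbf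 x)>0$ and $\mathbf U_h(\mathbf x)\in G$. Let $\Delta t>0$ satisfy, for all $K\in\mathcal T_h$, all edges $\mathscr E$ of $K$ and all $1\le\mu\le N$, $$\Delta t\left(\widetilde\alpha_K^F\frac{2|\mathscr E|\,p^{e,\star}_{\mathscr E,\mu}}{|K|\,p^{e,\rm int}_{\mathscr E,\mu}}+\widetilde\alpha_K^S\frac{\widehat\varpi_{\mathscr E}^{(\mu)}}{\omega_\mu}\right)\le\frac{\widehat\varpi_{\mathscr E}^{(\mu)}}{\omega_\mu},$$ where $$\widetilde\alpha_K^F=\max_{\mathscr E\subset\partial K,\,1\le\mu\le N}\max\big\{\alpha_{\mathbf n_{\mathscr E,K}}(\mathbf U^{\rm int}_{\mathscr E,\mu}),\alpha_{\mathbf n_{\mathscr E,K}}(\mathbf U^{\rm ext}_{\mathscr E,\mu})\big\},$$ $$\widetilde\alpha_K^S=\max_{1\le q\le Q}\frac{\|\nabla p_h^e(\mathbf x_K^{(q)})\|}{\rho_h^e(\mathbf x_K^{(q)})\sqrt{2e_h(\mathbf x_K^{(q)})}}+\frac{\big\|\sum_{\mathscr E\subset\partial K}|\mathscr E|\sum_{\mu}\omega_\mu[\![p_h^e]\!]_{\mathscr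 E,\mu}\,\mathbf n_{\mathscr E,K}\big\|}{2|K|\,\overline{(\rho_h^e)}_K\sqrt{2\overline e_K}},$$ and $e_h(\mathbf x)$, $\overline e_K$ are the specific internal energies $e$ of the states $\mathbf U_h(\mathbf x)$ and $\overline{\mathbf U}_K$. Then $\overline{\mathbf U}_K+\Delta t\,\mathbf L_K(\mathbf U_h)\in G$ for all $K\in\mathcal T_h$. -/

import Mathlib

open MeasureTheory Topology
open scoped RealInnerProductSpace

noncomputable section

/-! ## Physical states, fluxes and the HLLC flux -/

/-- The plane `ℝ²` with its Euclidean norm. -/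
abbrev Plane := EuclideanSpace ℝ (Fin 2)

/-- Conservative variables `U = (ρ, m, E)`. -/
abbrev State := ℝ × Plane × ℝ

namespace Euler

/-- Density `ρ`. -/
def density (U : State) : ℝ := U.1

/-- Momentum `m`. -/
def momentum (U : State) : Plane := U.2.1

/-- Total non-gravitational energy `E`. -/
def energy (U : State) : ℝ := U.2.2

/-- `𝒢(U) = E - ‖m‖² / (2ρ)`, which is `ρ e`. -/
def internalEnergy (U : State) : ℝ :=
  energy U - ‖momentum U‖ ^ 2 / (2 * density U)

/-- The set `G` of physically admissible states. -/
def G : Set State := {U | 0 < density U ∧ 0 < internalEnergy U}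

/-- Velocity `u = m / ρ`. -/
def velocity (U : State) : Plane := (density U)⁻¹ • momentum U

/-- Specific internal energy `e`. -/
def specificEnergy (U : State) : ℝ := internalEnergy U / density U

/-- Pressure of an ideal gas with adiabatic index `γ`. -/
def pressure (γ : ℝ) (U : State) : ℝ := (γ - 1) * internalEnergy U

/-- Sound speed `√(γ p / ρ)`. -/
def soundSpeed (γ : ℝ) (U : State) : ℝ := √(γ * pressure γ U / density U)

/-- `F(U) · w`, where the momentum rows of `F(U)` are `ρ u ⊗ u + p I`. -/
def flux (γ : ℝ) (U : State) (w : Plane) : State :=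
  (density U * ⟪velocity U, w⟫,
    (density U * ⟪velocity U, w⟫) • velocity U + pressure γ U • w,
    (energy U + pressure γ U) * ⟪velocity U, w⟫)

/-- `α_n(U) = |u · n| + √(γ p / ρ)`. -/
def alpha (γ : ℝ) (n : Plane) (U : State) : ℝ :=
  |⟪velocity U, n⟫| + soundSpeed γ U

/-- Left signal speed `S_L = min {(u·n - c)(U_L), (u·n - c)(U_R)}`. -/
def speedL (γ : ℝ) (UL UR : State) (n : Plane) : ℝ :=
  min (⟪velocity UL, n⟫ - soundSpeed γ UL) (⟪velocity UR, n⟫ - soundSpeed γ UR)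

/-- Right signal speed `S_R = max {(u·n + c)(U_L), (u·n + c)(U_R)}`. -/
def speedR (γ : ℝ) (UL UR : State) (n : Plane) : ℝ :=
  max (⟪velocity UL, n⟫ + soundSpeed γ UL) (⟪velocity UR, n⟫ + soundSpeed γ UR)

/-- Middle wave speed `S_*`. -/
def speedStar (γ : ℝ) (UL UR : State) (n : Plane) : ℝ :=
  let SL := speedL γ UL UR n
  let SR := speedR γ UL UR n
  let qL := ⟪velocity UL, n⟫
  let qR := ⟪velocity UR, n⟫
  (pressure γ UR - pressure γ UL
      + density UL * qL * (SL - qL) - density UR * qR * (SR - qR)) /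
    (density UL * (SL - qL) - density UR * (SR - qR))

/-- Intermediate state `U_{*i}` built from `U = U_i`, `S = S_i` and `Sstar = S_*`; the tangential
velocity of `U` is kept and its normal velocity is replaced by `Sstar`. -/
def starState (γ : ℝ) (U : State) (S Sstar : ℝ) (n : Plane) : State :=
  let q := ⟪velocity U, n⟫
  (density U * ((S - q) / (S - Sstar))) •
    ((1, velocity U + (Sstar - q) • n,
      energy U / density U
        + (Sstar - q) * (Sstar + pressure γ U / (density U * (S - q)))) : State)

/-- Intermediate flux `F_{*i} = F(U_i)·n + S_i (U_{*i} - U_i)`. -/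
def starFlux (γ : ℝ) (U : State) (S Sstar : ℝ) (n : Plane) : State :=
  flux γ U n + S • (starState γ U S Sstar n - U)

/-- The two-dimensional HLLC flux `F^hllc(U_L, U_R; n)`. -/
def hllc (γ : ℝ) (UL UR : State) (n : Plane) : State :=
  if 0 ≤ speedL γ UL UR n then flux γ UL n
  else if 0 ≤ speedStar γ UL UR n then
    starFlux γ UL (speedL γ UL UR n) (speedStar γ UL UR n) n
  else if 0 ≤ speedR γ UL UR n then
    starFlux γ UR (speedR γ UL UR n) (speedStar γ UL UR n) n
  else flux γ UR n

/-- `ρ`, `p` (with zero velocity) form a stationary hydrostatic solution on `Ω` for the potential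
`φ`: `∇p = -ρ ∇φ`. -/
def IsHydrostatic (Ω : Set Plane) (φ ρ p : Plane → ℝ) : Prop :=
  ∀ x ∈ Ω, DifferentiableAt ℝ φ x ∧ DifferentiableAt ℝ p x ∧
    gradient p x = -(ρ x • gradient φ x)

end Euler

/-! ## Polygonal meshes -/

/-- `n` is the unit normal, outward with respect to `K`, along the edge `[a, b]` of `K`: near each
relatively interior point `x` of the edge, `K` is the half-plane `{y | (y - x) · n ≤ 0}`. -/
def IsOutwardNormal (K : Set Plane) (a b n : Plane) : Prop :=
  ‖n‖ = 1 ∧ ∀ x ∈ openSegment ℝ a b, ∀ᶠ y in 𝓝 x, (y ∈ K ↔ ⟪y - x, n⟫ ≤ 0)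

/-- A partition of the domain `Ω` into closed polygons `cell K`, `K : C`, with straight edges
`[src e, tgt e]`, `e : E`. The cells need be neither convex nor simply connected, and may have any
number of edges (collinear adjacent edges are allowed); edges meet only in their end points. -/
structure PolygonalMesh (Ω : Set Plane) (C E : Type*) where
  isOpen_domain : IsOpen Ω
  /-- The two end points of an edge, in an order that does not depend on a cell. -/
  src : E → Plane
  tgt : E → Plane
  src_ne_tgt : ∀ e, src e ≠ tgt e
  disjoint_edges : ∀ e e', e ≠ e' →
    Disjoint (openSegment ℝ (src e) (tgt e)) (segment ℝ (src e') (tgt e'))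
  /-- The closed cell `K`. -/
  cell : C → Set Plane
  isCompact_cell : ∀ K, IsCompact (cell K)
  isConnected_interior : ∀ K, IsConnected (interior (cell K))
  /-- The edges of `K`. -/
  edges : C → Finset E
  frontier_cell : ∀ K, frontier (cell K) = ⋃ e ∈ edges K, segment ℝ (src e) (tgt e)
  /-- The outward unit normal `n_{e,K}`. -/
  normal : C → E → Plane
  isOutwardNormal : ∀ K, ∀ e ∈ edges K, IsOutwardNormal (cell K) (src e) (tgt e) (normal K e)
  disjoint_interior : ∀ K K', K ≠ K' → Disjoint (interior (cell K)) (interior (cell K'))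
  iUnion_cell : ⋃ K, cell K = closure Ω

/-! ## Quadrature rules -/

/-- `p(x)` for a polynomial `p` in two variables. -/
def evalAt (p : MvPolynomial (Fin 2) ℝ) (x : Plane) : ℝ := MvPolynomial.eval (fun i => x i) p

/-- `∇p(x)` for a polynomial `p` in two variables. -/
def gradAt (p : MvPolynomial (Fin 2) ℝ) (x : Plane) : Plane :=
  !₂[evalAt (MvPolynomial.pderiv 0 p) x, evalAt (MvPolynomial.pderiv 1 p) x]

/-- The `N`-point Gauss quadrature on `[0, 1]`, with normalized weights: the `N`-point rule that is
exact for polynomials of degree at most `2N - 1`. Exactness determines it up to the numbering of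
the nodes: they are the `N` distinct zeros of the shifted Legendre polynomial. -/
structure GaussRule (N : ℕ) where
  node : Fin N → ℝ
  weight : Fin N → ℝ
  exact : ∀ p : Polynomial ℝ, p.natDegree < 2 * N →
    ∑ μ, weight μ * p.eval (node μ) = ∫ s in (0 : ℝ)..1, p.eval s

/-- A quadrature rule on a cell with nonnegative, normalized weights that is exact for polynomials
of total degree at most `k`. -/
structure CellQuadrature (K : Set Plane) (k : ℕ) where
  size : ℕ
  node : Fin size → Plane
  weight : Fin size → ℝ
  node_mem : ∀ q, node q ∈ K
  weight_nonneg : ∀ q, 0 ≤ weight q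
  exact : ∀ p : MvPolynomial (Fin 2) ℝ, p.totalDegree ≤ k →
    ∑ q, weight q * evalAt p (node q) = ⨍ x in K, evalAt p x

namespace PolygonalMesh

variable {Ω : Set Plane} {C E : Type*} (T : PolygonalMesh Ω C E)

/-- The area `|K|`. -/
def area (K : C) : ℝ := volume.real (T.cell K)

/-- The length `|e|` of an edge. -/
def edgeLength (e : E) : ℝ := dist (T.src e) (T.tgt e)

/-- The Gauss point `x_e^{(μ)}` on the edge `e`. -/
def gaussPoint {N : ℕ} (g : GaussRule N) (e : E) (μ : Fin N) : Plane :=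
  T.src e + g.node μ • (T.tgt e - T.src e)

open Classical in
/-- The cell on the other side of the edge `e` of `K`, or `none` if `e` lies on the boundary of the
domain. -/
def neighbour (K : C) (e : E) : Option C :=
  if h : ∃ K', K' ≠ K ∧ e ∈ T.edges K' then some h.choose else none

/-- The special quadrature on the cell `K`: all weights are positive, the nodes are all the Gauss
points on all the edges of `K` together with finitely many further points of `K`, and the rule is
exact for polynomials of total degree at most `k`. -/
structure SpecialQuadrature {N : ℕ} (g : GaussRule N) (k : ℕ) (K : C) where
  edgeWeight : E → Fin N → ℝ
  size : ℕ
  node : Fin size → Plane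
  weight : Fin size → ℝ
  node_mem : ∀ q, node q ∈ T.cell K
  edgeWeight_pos : ∀ e ∈ T.edges K, ∀ μ, 0 < edgeWeight e μ
  weight_pos : ∀ q, 0 < weight q
  exact : ∀ p : MvPolynomial (Fin 2) ℝ, p.totalDegree ≤ k →
    ∑ e ∈ T.edges K, ∑ μ, edgeWeight e μ * evalAt p (T.gaussPoint g e μ)
      + ∑ q, weight q * evalAt p (node q) = ⨍ x in T.cell K, evalAt p x

end PolygonalMesh

/-! ## The discontinuous Galerkin space -/

/-- The space `𝕍_h^k` of discontinuous piecewise polynomials: one polynomial of total degree at most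
`k` on each cell. -/
abbrev DGSpace (C : Type*) (k : ℕ) := C → MvPolynomial.restrictTotalDegree (Fin 2) ℝ k

namespace DGSpace

variable {C : Type*} {k : ℕ}

/-- The value at `x` of the polynomial on the cell `K` (for `x` on an edge of `K`: the trace taken
from the interior of `K`). -/
def val (u : DGSpace C k) (K : C) (x : Plane) : ℝ := evalAt (u K) x

/-- The gradient at `x` of the polynomial on the cell `K`. -/
def grad (u : DGSpace C k) (K : C) (x : Plane) : Plane := gradAt (u K) x

/-- The cell average over `K`. -/
def avg {Ω : Set Plane} {E : Type*} (T : PolygonalMesh Ω C E) (u : DGSpace C k) (K : C) : ℝ :=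
  ⨍ x in T.cell K, u.val K x

end DGSpace

/-- `P` is a projection of functions onto `𝕍_h^k`: it has values in `𝕍_h^k`, and it reproduces each
function that coincides with an element of `𝕍_h^k` inside the cells. -/
def PolygonalMesh.IsProjection {Ω : Set Plane} {C E : Type*} (T : PolygonalMesh Ω C E) {k : ℕ}
    (P : (Plane → ℝ) → DGSpace C k) : Prop :=
  ∀ (u : Plane → ℝ) (w : DGSpace C k),
    (∀ K, ∀ x ∈ interior (T.cell K), u x = w.val K x) → P u = w

/-- A numerical solution `U_h`, all of whose components belong to `𝕍_h^k`. -/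
structure DGState (C : Type*) (k : ℕ) where
  density : DGSpace C k
  momentum : Fin 2 → DGSpace C k
  energy : DGSpace C k

namespace DGState

variable {C : Type*} {k : ℕ}

/-- `U_h(x)`, computed from the polynomials on the cell `K`. -/
def val (U : DGState C k) (K : C) (x : Plane) : State :=
  (U.density.val K x, !₂[(U.momentum 0).val K x, (U.momentum 1).val K x], U.energy.val K x)

/-- The cell average of `U_h` over `K`. -/
def avg {Ω : Set Plane} {E : Type*} (T : PolygonalMesh Ω C E) (U : DGState C k) (K : C) : State :=
  (U.density.avg T K, !₂[(U.momentum 0).avg T K, (U.momentum 1).avg T K], U.energy.avg T K)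

end DGState

/-! ## The well-balanced scheme -/

/-- The data of the well-balanced DG scheme of degree `k` on the mesh `T`. -/
structure WBScheme {Ω : Set Plane} {C E : Type*} (T : PolygonalMesh Ω C E) (k : ℕ) where
  /-- The adiabatic index. -/
  γ : ℝ
  /-- The Gauss rule, with `k + 1` points, on the edges. -/
  gauss : GaussRule (k + 1)
  /-- The quadrature on the cells. -/
  quad : ∀ K, CellQuadrature (T.cell K) k
  /-- The projected equilibrium density `ρ_h^e`. -/
  ρe : DGSpace C k
  /-- The projected equilibrium pressure `p_h^e`. -/
  pe : DGSpace C k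
  /-- Exterior values of `p_h^e` at the Gauss points of boundary edges. -/
  peBdry : E → Fin (k + 1) → ℝ

namespace WBScheme

open Euler

variable {Ω : Set Plane} {C E : Type*} {T : PolygonalMesh Ω C E} {k : ℕ}

/-- `p^{e,int(K)}` at the `μ`-th Gauss point of `e`. -/
def peInt (S : WBScheme T k) (K : C) (e : E) (μ : Fin (k + 1)) : ℝ :=
  S.pe.val K (T.gaussPoint S.gauss e μ)

/-- `p^{e,ext(K)}` at the `μ`-th Gauss point of `e`. -/
def peExt (S : WBScheme T k) (K : C) (e : E) (μ : Fin (k + 1)) : ℝ :=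
  match T.neighbour K e with
  | some K' => S.pe.val K' (T.gaussPoint S.gauss e μ)
  | none => S.peBdry e μ

/-- `p^{e,⋆} = (p^{e,int(K)} + p^{e,ext(K)}) / 2`. -/
def peStar (S : WBScheme T k) (K : C) (e : E) (μ : Fin (k + 1)) : ℝ :=
  (S.peInt K e μ + S.peExt K e μ) / 2

/-- The jump `p^{e,ext(K)} - p^{e,int(K)}`. -/
def peJump (S : WBScheme T k) (K : C) (e : E) (μ : Fin (k + 1)) : ℝ :=
  S.peExt K e μ - S.peInt K e μ

/-- `U_h^{int(K)}` at the `μ`-th Gauss point of `e`. -/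
def UInt (S : WBScheme T k) (U : DGState C k) (K : C) (e : E) (μ : Fin (k + 1)) : State :=
  U.val K (T.gaussPoint S.gauss e μ)

/-- `U_h^{ext(K)}` at the `μ`-th Gauss point of `e`; `UBdry` gives the exterior states on boundary
edges. -/
def UExt (S : WBScheme T k) (U : DGState C k) (UBdry : E → Fin (k + 1) → State)
    (K : C) (e : E) (μ : Fin (k + 1)) : State :=
  match T.neighbour K e with
  | some K' => U.val K' (T.gaussPoint S.gauss e μ)
  | none => UBdry e μ

/-- The modified HLLC flux at the `μ`-th Gauss point of the edge `e` of `K`. -/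
def numFlux (S : WBScheme T k) (U : DGState C k) (UBdry : E → Fin (k + 1) → State)
    (K : C) (e : E) (μ : Fin (k + 1)) : State :=
  hllc S.γ ((S.peStar K e μ / S.peInt K e μ) • S.UInt U K e μ)
    ((S.peStar K e μ / S.peExt K e μ) • S.UExt U UBdry K e μ) (T.normal K e)

/-- The bracket `∑_e |e| ∑_μ ω_μ p^{e,⋆} v n - |K| ∑_q ϖ_q p_h^e ∇v` of the source terms. -/
def sourceBracket (S : WBScheme T k) (K : C) (v : MvPolynomial (Fin 2) ℝ) : Plane :=
  ∑ e ∈ T.edges K, T.edgeLength e • ∑ μ,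
      (S.gauss.weight μ * S.peStar K e μ * evalAt v (T.gaussPoint S.gauss e μ)) • T.normal K e
    - T.area K • ∑ q, ((S.quad K).weight q * S.pe.val K ((S.quad K).node q)) •
        gradAt v ((S.quad K).node q)

/-- The approximation `⟨S^[2], v⟩_K` of the momentum source term. -/
def sourceMomentum (S : WBScheme T k) (U : DGState C k) (K : C)
    (v : MvPolynomial (Fin 2) ℝ) : Plane :=
  T.area K • ∑ q, ((S.quad K).weight q *
      (density (U.val K ((S.quad K).node q)) / S.ρe.val K ((S.quad K).node q)
        - density (U.avg T K) / S.ρe.avg T K) *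
      evalAt v ((S.quad K).node q)) • S.pe.grad K ((S.quad K).node q)
    + (density (U.avg T K) / S.ρe.avg T K) • S.sourceBracket K v

/-- The approximation `⟨S^[3], v⟩_K` of the energy source term. -/
def sourceEnergy (S : WBScheme T k) (U : DGState C k) (K : C)
    (v : MvPolynomial (Fin 2) ℝ) : ℝ :=
  T.area K * ∑ q, (S.quad K).weight q *
      ⟪(S.ρe.val K ((S.quad K).node q))⁻¹ • momentum (U.val K ((S.quad K).node q))
        - (S.ρe.avg T K)⁻¹ • momentum (U.avg T K), S.pe.grad K ((S.quad K).node q)⟫ *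
      evalAt v ((S.quad K).node q)
    + ⟪(S.ρe.avg T K)⁻¹ • momentum (U.avg T K), S.sourceBracket K v⟫

/-- The right-hand side of the well-balanced DG scheme `∫_K (U_h)_t v = …` on the cell `K` for the
test function `v`. -/
def rhs (S : WBScheme T k) (U : DGState C k) (UBdry : E → Fin (k + 1) → State) (K : C)
    (v : MvPolynomial (Fin 2) ℝ) : State :=
  T.area K • ∑ q, (S.quad K).weight q •
      flux S.γ (U.val K ((S.quad K).node q)) (gradAt v ((S.quad K).node q))
    + (0, S.sourceMomentum U K v, S.sourceEnergy U K v)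
    - ∑ e ∈ T.edges K, T.edgeLength e • ∑ μ,
        (S.gauss.weight μ * evalAt v (T.gaussPoint S.gauss e μ)) • S.numFlux U UBdry K e μ

/-- `L_K(U_h)`: the scheme with the test function `v = 1`, divided by `|K|`; thus the cell averages
evolve by `d/dt avg_K(U_h) = L_K(U_h)`. -/
def L (S : WBScheme T k) (U : DGState C k) (UBdry : E → Fin (k + 1) → State) (K : C) : State :=
  (T.area K)⁻¹ • S.rhs U UBdry K 1

/-- The point set `𝕊_K`: the Gauss points on the edges of `K`, the other nodes of the special
quadrature, and the nodes of the quadrature used in the scheme. -/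
def pointSet (S : WBScheme T k) {K : C} (Q : T.SpecialQuadrature S.gauss k K) : Set Plane :=
  {x | ∃ e ∈ T.edges K, ∃ μ, x = T.gaussPoint S.gauss e μ} ∪ Set.range Q.node ∪
    Set.range (S.quad K).node

/-- The flux-speed bound `α̃_K^F`. -/
def alphaF (S : WBScheme T k) (U : DGState C k) (UBdry : E → Fin (k + 1) → State) (K : C) : ℝ :=
  max (⨆ i : T.edges K × Fin (k + 1), alpha S.γ (T.normal K i.1) (S.UInt U K i.1 i.2))
    (⨆ i : T.edges K × Fin (k + 1), alpha S.γ (T.normal K i.1) (S.UExt U UBdry K i.1 i.2))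

/-- `α̃_K^{S,1}`. -/
def alphaS1 (S : WBScheme T k) (U : DGState C k) (K : C) : ℝ :=
  ⨆ q, ‖S.pe.grad K ((S.quad K).node q)‖ /
    (S.ρe.val K ((S.quad K).node q) * √(2 * specificEnergy (U.val K ((S.quad K).node q))))

/-- `α̃_K^{S,2}`. -/
def alphaS2 (S : WBScheme T k) (U : DGState C k) (K : C) : ℝ :=
  ‖∑ e ∈ T.edges K, (T.edgeLength e * ∑ μ, S.gauss.weight μ * S.peJump K e μ) • T.normal K e‖ /
    (2 * T.area K * S.ρe.avg T K * √(2 * specificEnergy (U.avg T K)))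

/-- The source bound `α̃_K^S`. -/
def alphaS (S : WBScheme T k) (U : DGState C k) (K : C) : ℝ := S.alphaS1 U K + S.alphaS2 U K

end WBScheme

end


/-!
The set `G` is an open convex cone cut out by linear inequalities: `E - m · v + ρ ‖v‖² / 2 > 0` for
every velocity `v`. Being cut out linearly, it absorbs sums with its closure, so it suffices to
write the updated cell average as a sum of admissible pieces.

For the fluxes, the HLLC flux is `F(U_L) · n` plus the waves moving to the left, so that
`2 α U_L - F^hllc` is admissible as soon as `α` dominates the wave speeds; the intermediate states
are admissible because `S_*` lies strictly between the outer speeds. For the sources, an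
acceleration `a` moves `U` by `(0, ρ a, m · a)`, which stays in the closed cone after adding `α U`
when `α ≥ ‖a‖ / √(2 e)`.

The discrete divergence theorem, which holds because both quadratures are exact on `∇p_h^e` and on
its traces, removes the interior traces of the pressure from the source terms at `v = 1`: what
remains are accelerations at the quadrature nodes and one acceleration of the cell average by the
pressure jumps. The part `Δt α̃_K^S` of the cell average pays for the sources, and the rest, split
by the special quadrature, pays for the flux at each Gauss point; the CFL condition says precisely
that this budget suffices. For general polygons the divergence theorem itself is reduced to
one-dimensional slices, along which the indicator function of the cell is a sum of half-line
indicators, one for each edge crossed.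
-/

namespace Euler

variable {γ α : ℝ} {n v : Plane} {U V UL UR : State}

section Admissible

/-- The state of density `ρ`, velocity `u` and specific internal energy `e`. -/
noncomputable def primState (ρ : ℝ) (u : Plane) (e : ℝ) : State := (ρ, ρ • u, ρ * (e + ‖u‖ ^ 2 / 2))

theorem eq_primState (hU : density U ≠ 0) :
    U = primState (density U) (velocity U) (specificEnergy U) := by
  obtain ⟨r, m, E⟩ := U
  have hr : r ≠ 0 := hU
  simp only [primState, density, velocity, specificEnergy, internalEnergy, momentum, energy,
    smul_inv_smul₀ hr, norm_smul, norm_inv, mul_pow, Real.norm_eq_abs, inv_pow, sq_abs]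
  congr 2
  field_simp
  ring

theorem momentum_eq_smul_velocity (hU : density U ≠ 0) : momentum U = density U • velocity U :=
  (smul_inv_smul₀ hU _).symm

theorem internalEnergy_eq_density_mul (hU : density U ≠ 0) :
    internalEnergy U = density U * specificEnergy U :=
  (mul_div_cancel₀ _ hU).symm

theorem specificEnergy_pos (hU : U ∈ G) : 0 < specificEnergy U := div_pos hU.2 hU.1

theorem pressure_pos (hγ : 1 < γ) (hU : U ∈ G) : 0 < pressure γ U :=
  mul_pos (sub_pos.2 hγ) hU.2

/-- The functional `U ↦ E - m · v + ρ ‖v‖² / 2`, the energy in a frame moving with velocity `v`. At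
fixed `U` of positive density its minimum over `v` is `ρ e`, so that `G` is an intersection of
half-spaces (geometric quasilinearization). -/
noncomputable def shiftedEnergy (v : Plane) : State →ₗ[ℝ] ℝ where
  toFun U := energy U - ⟪momentum U, v⟫ + density U * (‖v‖ ^ 2 / 2)
  map_add' U V := by
    simp only [energy, momentum, density, Prod.fst_add, Prod.snd_add, inner_add_left]
    ring
  map_smul' c U := by
    simp only [energy, momentum, density, Prod.smul_fst, Prod.smul_snd, real_inner_smul_left,
      smul_eq_mul, RingHom.id_apply]
    ring

theorem shiftedEnergy_apply (v : Plane) (U : State) :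
    shiftedEnergy v U = energy U - ⟪momentum U, v⟫ + density U * (‖v‖ ^ 2 / 2) := rfl

theorem shiftedEnergy_primState (v : Plane) (ρ : ℝ) (u : Plane) (e : ℝ) :
    shiftedEnergy v (primState ρ u e) = ρ * (e + ‖u - v‖ ^ 2 / 2) := by
  simp only [shiftedEnergy_apply, energy, momentum, density, primState, real_inner_smul_left,
    norm_sub_sq_real]
  ring

theorem shiftedEnergy_eq (hU : density U ≠ 0) (v : Plane) :
    shiftedEnergy v U = density U * (specificEnergy U + ‖velocity U - v‖ ^ 2 / 2) := by
  rw [← shiftedEnergy_primState, ← eq_primState hU]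

theorem mem_G_iff : U ∈ G ↔ 0 < density U ∧ ∀ v, 0 < shiftedEnergy v U := by
  refine and_congr_right fun hρ => ?_
  have hne := hρ.ne'
  rw [internalEnergy_eq_density_mul hne]
  simp only [shiftedEnergy_eq hne, mul_pos_iff_of_pos_left hρ]
  exact ⟨fun he v => by positivity, fun h => by simpa using h (velocity U)⟩

theorem primState_mem_G {ρ e : ℝ} (hρ : 0 < ρ) (u : Plane) (he : 0 < e) : primState ρ u e ∈ G :=
  mem_G_iff.2 ⟨hρ, fun v => by rw [shiftedEnergy_primState]; positivity⟩

/-- The closed convex cone of the states of nonnegative density and internal energy, the latter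
expressed through `shiftedEnergy`. Adding one of its elements to a state in `G` does not leave
`G`. -/
noncomputable def admissibleCone : PointedCone ℝ State where
  carrier := {U | 0 ≤ density U ∧ ∀ v, 0 ≤ shiftedEnergy v U}
  add_mem' hU hV := ⟨add_nonneg hU.1 hV.1, fun v => by
    rw [map_add]; exact add_nonneg (hU.2 v) (hV.2 v)⟩
  zero_mem' := ⟨le_refl (0 : ℝ), fun v => (map_zero (shiftedEnergy v)).ge⟩
  smul_mem' c _ hU := ⟨mul_nonneg c.2 hU.1, fun v =>
    (mul_nonneg c.2 (hU.2 v)).trans_eq (map_smul (shiftedEnergy v) (c : ℝ) _).symm⟩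

theorem mem_admissibleCone_of_mem_G (hU : U ∈ G) : U ∈ admissibleCone :=
  ⟨hU.1.le, fun v => ((mem_G_iff.1 hU).2 v).le⟩

theorem add_mem_G (hU : U ∈ G) (hV : V ∈ admissibleCone) : U + V ∈ G := by
  rw [mem_G_iff] at hU ⊢
  refine ⟨add_pos_of_pos_of_nonneg hU.1 hV.1, fun v => ?_⟩
  rw [map_add]
  exact add_pos_of_pos_of_nonneg (hU.2 v) (hV.2 v)

theorem smul_mem_G {c : ℝ} (hc : 0 < c) (hU : U ∈ G) : c • U ∈ G := by
  rw [mem_G_iff] at hU ⊢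
  refine ⟨mul_pos hc hU.1, fun v => ?_⟩
  rw [map_smul]
  exact mul_pos hc (hU.2 v)

theorem convex_G : Convex ℝ G :=
  convex_iff_forall_pos.2 fun _ hU _ hV _ _ ha hb _ =>
    add_mem_G (smul_mem_G ha hU) (mem_admissibleCone_of_mem_G (smul_mem_G hb hV))

theorem sum_mem_G {ι : Type*} {s : Finset ι} (hs : s.Nonempty) {f : ι → State}
    (h : ∀ i ∈ s, f i ∈ G) : ∑ i ∈ s, f i ∈ G :=
  Finset.sum_induction_nonempty f (· ∈ G)
    (fun _ _ hU hV => add_mem_G hU (mem_admissibleCone_of_mem_G hV)) hs h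

/-- The rate of change `(0, ρ a, m · a)` of a state subject to the acceleration `a`: the shape of
the gravitational source terms. -/
noncomputable def accelerate (U : State) (a : Plane) : State := (0, density U • a, ⟪momentum U, a⟫)

theorem shiftedEnergy_accelerate (hU : density U ≠ 0) (v a : Plane) :
    shiftedEnergy v (accelerate U a) = density U * ⟪velocity U - v, a⟫ := by
  have h_def : shiftedEnergy v (accelerate U a)
      = ⟪momentum U, a⟫ - ⟪density U • a, v⟫ + 0 * (‖v‖ ^ 2 / 2) := rfl
  rw [h_def, momentum_eq_smul_velocity hU, real_inner_smul_left, real_inner_smul_left,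
    inner_sub_left, real_inner_comm a v]
  ring

theorem smul_add_accelerate_mem_admissibleCone (hU : U ∈ G) {a : Plane}
    (hα : ‖a‖ / √(2 * specificEnergy U) ≤ α) : α • U + accelerate U a ∈ admissibleCone := by
  have he := specificEnergy_pos hU
  set s := √(2 * specificEnergy U) with hs
  have hs0 : 0 < s := by positivity
  have hs2 : s ^ 2 = 2 * specificEnergy U := Real.sq_sqrt (by positivity)
  have hα0 : 0 ≤ α := (by positivity : 0 ≤ ‖a‖ / s).trans hα
  rw [div_le_iff₀ hs0] at hα
  refine ⟨?_, fun v => ?_⟩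
  · exact add_nonneg (mul_nonneg hα0 hU.1.le) le_rfl
  set w := velocity U - v with hw
  rw [map_add, map_smul, shiftedEnergy_eq hU.1.ne', shiftedEnergy_accelerate hU.1.ne', smul_eq_mul,
    ← hw]
  have h_inner : -(‖w‖ * (α * s)) ≤ ⟪w, a⟫ :=
    (neg_le_neg (by gcongr)).trans (abs_le.1 (abs_real_inner_le_norm w a)).1
  have h_amgm : ‖w‖ * s ≤ specificEnergy U + ‖w‖ ^ 2 / 2 := by
    linarith [two_mul_le_add_sq ‖w‖ s]
  have := mul_le_mul_of_nonneg_left h_amgm hα0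
  have : 0 ≤ α * (specificEnergy U + ‖w‖ ^ 2 / 2) + ⟪w, a⟫ := by linarith
  linarith [mul_nonneg hU.1.le this]

end Admissible

section Waves

theorem sq_soundSpeed (hγ : 1 < γ) (hU : U ∈ G) :
    soundSpeed γ U ^ 2 = γ * (γ - 1) * specificEnergy U := by
  have := pressure_pos hγ hU
  have := hU.1
  rw [soundSpeed, Real.sq_sqrt (by positivity), pressure, specificEnergy]
  ring

theorem soundSpeed_pos (hγ : 1 < γ) (hU : U ∈ G) : 0 < soundSpeed γ U := by
  have := pressure_pos hγ hU
  have := hU.1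
  exact Real.sqrt_pos.2 (by positivity)

theorem alpha_pos (hγ : 1 < γ) (n : Plane) (hU : U ∈ G) : 0 < alpha γ n U :=
  add_pos_of_nonneg_of_pos (abs_nonneg _) (soundSpeed_pos hγ hU)

theorem pressure_lt_density_mul_sq_soundSpeed (hγ : 1 < γ) (hU : U ∈ G) :
    pressure γ U < density U * soundSpeed γ U ^ 2 := by
  have hp := pressure_pos hγ hU
  calc pressure γ U < γ * pressure γ U := by nlinarith
    _ = density U * soundSpeed γ U ^ 2 := by
      rw [sq_soundSpeed hγ hU, pressure, internalEnergy_eq_density_mul hU.1.ne']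
      ring

theorem sq_pressure_div_density_lt (hγ : 1 < γ) (hU : U ∈ G) {a : ℝ}
    (ha : soundSpeed γ U ≤ |a|) :
    (pressure γ U / density U) ^ 2 < 2 * a ^ 2 * specificEnergy U := by
  have he := specificEnergy_pos hU
  have ha2 : γ * (γ - 1) * specificEnergy U ≤ a ^ 2 := by
    rw [← sq_soundSpeed hγ hU, ← sq_abs a]
    exact pow_le_pow_left₀ (soundSpeed_pos hγ hU).le ha 2
  calc (pressure γ U / density U) ^ 2
      = (γ - 1) * (γ - 1) * specificEnergy U * specificEnergy U := by
        rw [pressure, specificEnergy]; ring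
    _ < 2 * γ * (γ - 1) * specificEnergy U * specificEnergy U := by gcongr; linarith
    _ ≤ 2 * a ^ 2 * specificEnergy U := by nlinarith

/-- The flux `(0, p n, p s)` exerted by a pressure `p` across a line with normal `n` that moves with
normal speed `s`. -/
noncomputable def pressureFlux (p s : ℝ) (n : Plane) : State := (0, p • n, p * s)

theorem shiftedEnergy_pressureFlux (v : Plane) (p s : ℝ) (n : Plane) :
    shiftedEnergy v (pressureFlux p s n) = p * (s - ⟪v, n⟫) := by
  simp only [shiftedEnergy_apply, pressureFlux, energy, momentum, density, real_inner_smul_left,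
    real_inner_comm v n]
  ring

theorem flux_eq_smul_add_pressureFlux (hU : density U ≠ 0) :
    flux γ U n = ⟪velocity U, n⟫ • U + pressureFlux (pressure γ U) ⟪velocity U, n⟫ n := by
  have hm := momentum_eq_smul_velocity hU
  ext1
  · simp [flux, pressureFlux, density, mul_comm]
  ext1
  · simp [flux, pressureFlux, ← momentum.eq_def, hm, smul_smul, mul_comm]
  · simp [flux, pressureFlux, ← energy.eq_def]
    ring

theorem smul_sub_flux_mem_G (hγ : 1 < γ) (hn : ‖n‖ = 1) (hU : U ∈ G) (hα : alpha γ n U ≤ α) :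
    α • U - flux γ U n ∈ G := by
  obtain ⟨a, ha⟩ : ∃ a, α - ⟪velocity U, n⟫ = a := ⟨_, rfl⟩
  have hca : soundSpeed γ U ≤ a := by
    rw [alpha] at hα
    linarith [le_abs_self ⟪velocity U, n⟫]
  have ha0 : 0 < a := (soundSpeed_pos hγ hU).trans_le hca
  have h_eq : α • U - flux γ U n
      = a • U - pressureFlux (pressure γ U) ⟪velocity U, n⟫ n := by
    rw [flux_eq_smul_add_pressureFlux hU.1.ne', ← ha]
    module
  rw [h_eq]
  refine mem_G_iff.2 ⟨by simpa [density, pressureFlux] using mul_pos ha0 hU.1, fun v => ?_⟩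
  obtain ⟨P, hP⟩ : ∃ P, pressure γ U / density U = P := ⟨_, rfl⟩
  have hP0 : 0 < P := hP ▸ div_pos (pressure_pos hγ hU) hU.1
  have h_inner : P * ⟪velocity U - v, n⟫ ≤ P * ‖velocity U - v‖ := by
    gcongr
    simpa [hn] using real_inner_le_norm (velocity U - v) n
  have h_sound : P ^ 2 < 2 * a ^ 2 * specificEnergy U :=
    hP ▸ sq_pressure_div_density_lt hγ hU (hca.trans (le_abs_self a))
  have h_pos : 0 < a * (specificEnergy U + ‖velocity U - v‖ ^ 2 / 2) - P * ‖velocity U - v‖ := by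
    refine pos_of_mul_pos_right (a := a) ?_ ha0.le
    nlinarith [sq_nonneg (a * ‖velocity U - v‖ - P)]
  have h_split : shiftedEnergy v (a • U - pressureFlux (pressure γ U) ⟪velocity U, n⟫ n)
      = density U * (a * (specificEnergy U + ‖velocity U - v‖ ^ 2 / 2)
        - P * ⟪velocity U - v, n⟫) := by
    rw [map_sub, map_smul, shiftedEnergy_eq hU.1.ne', shiftedEnergy_pressureFlux, ← hP,
      inner_sub_left, smul_eq_mul]
    field_simp [hU.1.ne']
  rw [h_split]
  exact mul_pos hU.1 (h_pos.trans_le (by linarith))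

theorem starState_eq_primState (hn : ‖n‖ = 1) (hU : density U ≠ 0) (S Sstar : ℝ) :
    starState γ U S Sstar n =
      primState (density U * ((S - ⟪velocity U, n⟫) / (S - Sstar)))
        (velocity U + (Sstar - ⟪velocity U, n⟫) • n)
        (specificEnergy U + (Sstar - ⟪velocity U, n⟫) ^ 2 / 2
          + (Sstar - ⟪velocity U, n⟫)
            * (pressure γ U / density U / (S - ⟪velocity U, n⟫))) := by
  have hE : energy U / density U = specificEnergy U + ‖velocity U‖ ^ 2 / 2 := by
    rw [div_eq_iff hU, mul_comm]
    exact congrArg energy (eq_primState hU)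
  simp only [starState, primState, Prod.smul_mk, smul_eq_mul, mul_one, Prod.mk.injEq, true_and, hE]
  rw [norm_add_sq_real, norm_smul, hn, real_inner_smul_right, div_div, mul_one, Real.norm_eq_abs,
    sq_abs]
  ring

theorem starState_mem_G (hγ : 1 < γ) (hn : ‖n‖ = 1) (hU : U ∈ G) {S Sstar : ℝ}
    (hS : soundSpeed γ U ≤ |S - ⟪velocity U, n⟫|)
    (hSstar : 0 < (S - ⟪velocity U, n⟫) / (S - Sstar)) :
    starState γ U S Sstar n ∈ G := by
  rw [starState_eq_primState hn hU.1.ne']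
  refine primState_mem_G (mul_pos hU.1 hSstar) _ ?_
  have h_sound := sq_pressure_div_density_lt hγ hU hS
  generalize pressure γ U / density U = P at *
  generalize Sstar - ⟪velocity U, n⟫ = d
  obtain ⟨a, ha⟩ : ∃ a, S - ⟪velocity U, n⟫ = a := ⟨_, rfl⟩
  rw [ha] at hS hSstar h_sound ⊢
  have ha0 : a ≠ 0 := by
    rintro rfl
    simp at hSstar
  have h_square : specificEnergy U + d ^ 2 / 2 + d * (P / a)
      = ((2 * a ^ 2 * specificEnergy U - P ^ 2) + (a * d + P) ^ 2) / (2 * a ^ 2) := by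
    field_simp
    ring
  rw [h_square]
  have := sub_pos.2 h_sound
  positivity

/-- The pressure `p + ρ (S - q) (S_* - q)`, with `q = u · n`, behind a wave of speed `S` running
into `U`. -/
noncomputable def starPressure (γ : ℝ) (U : State) (S Sstar : ℝ) (n : Plane) : ℝ :=
  pressure γ U + density U * (S - ⟪velocity U, n⟫) * (Sstar - ⟪velocity U, n⟫)

theorem starFlux_eq_smul_add_pressureFlux (hU : density U ≠ 0) {S Sstar : ℝ}
    (hS : S ≠ ⟪velocity U, n⟫) (hSstar : S ≠ Sstar) :
    starFlux γ U S Sstar n =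
      Sstar • starState γ U S Sstar n + pressureFlux (starPressure γ U S Sstar n) Sstar n := by
  have hS' := sub_ne_zero.2 hS
  have hSstar' := sub_ne_zero.2 hSstar
  have hm := momentum_eq_smul_velocity hU
  rw [starFlux, flux_eq_smul_add_pressureFlux hU]
  simp only [starState, pressureFlux, starPressure]
  generalize hu : velocity U = u at *
  obtain ⟨r, m, E⟩ := U
  simp only [density, momentum, energy] at *
  subst hm
  simp only [Prod.smul_mk, Prod.mk_add_mk, Prod.mk_sub_mk, smul_eq_mul, Prod.mk.injEq]
  refine ⟨?_, ?_, ?_⟩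
  · field_simp
    ring
  · match_scalars <;> field_simp <;> ring
  · field_simp
    ring

end Waves

section HLLC

theorem neg_le_speedL (hαL : alpha γ n UL ≤ α) (hαR : alpha γ n UR ≤ α) :
    -α ≤ speedL γ UL UR n := by
  rw [alpha] at hαL hαR
  exact le_min (by linarith [neg_abs_le ⟪velocity UL, n⟫])
    (by linarith [neg_abs_le ⟪velocity UR, n⟫])

theorem speedL_le_left : speedL γ UL UR n ≤ ⟪velocity UL, n⟫ - soundSpeed γ UL := min_le_left _ _

theorem speedL_le_right : speedL γ UL UR n ≤ ⟪velocity UR, n⟫ - soundSpeed γ UR := min_le_right _ _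

theorem left_le_speedR : ⟪velocity UL, n⟫ + soundSpeed γ UL ≤ speedR γ UL UR n := le_max_left _ _

theorem right_le_speedR : ⟪velocity UR, n⟫ + soundSpeed γ UR ≤ speedR γ UL UR n := le_max_right _ _

variable (hγ : 1 < γ) (hL : UL ∈ G) (hR : UR ∈ G)

include hγ hL hR

theorem speedStar_denom_neg :
    density UL * (speedL γ UL UR n - ⟪velocity UL, n⟫)
      - density UR * (speedR γ UL UR n - ⟪velocity UR, n⟫) < 0 := by
  have hcL := soundSpeed_pos hγ hL
  have hcR := soundSpeed_pos hγ hR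
  have hSL := speedL_le_left (γ := γ) (n := n) (UL := UL) (UR := UR)
  have hSR := right_le_speedR (γ := γ) (n := n) (UL := UL) (UR := UR)
  have hleft := mul_neg_of_pos_of_neg hL.1
    (show speedL γ UL UR n - ⟪velocity UL, n⟫ < 0 by linarith)
  have hright := mul_pos hR.1 (show 0 < speedR γ UL UR n - ⟪velocity UR, n⟫ by linarith)
  linarith

theorem starPressure_left_eq_right :
    starPressure γ UL (speedL γ UL UR n) (speedStar γ UL UR n) n
      = starPressure γ UR (speedR γ UL UR n) (speedStar γ UL UR n) n := by
  have h := (eq_div_iff (speedStar_denom_neg (n := n) hγ hL hR).ne).1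
    (show speedStar γ UL UR n = _ from rfl)
  simp only [starPressure]
  linarith

theorem speedL_lt_speedStar : speedL γ UL UR n < speedStar γ UL UR n := by
  have hcR := soundSpeed_pos hγ hR
  have hSL := speedL_le_right (γ := γ) (n := n) (UL := UL) (UR := UR)
  have hSR := right_le_speedR (γ := γ) (n := n) (UL := UL) (UR := UR)
  rw [speedStar, lt_div_iff_of_neg (speedStar_denom_neg hγ hL hR)]
  have h_speeds : soundSpeed γ UR * soundSpeed γ UR ≤ (⟪velocity UR, n⟫ - speedL γ UL UR n)
      * (speedR γ UL UR n - ⟪velocity UR, n⟫) :=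
    mul_le_mul (by linarith) (by linarith) hcR.le (by linarith)
  have := mul_le_mul_of_nonneg_left h_speeds hR.1.le
  have := mul_nonneg hL.1.le (sq_nonneg (speedL γ UL UR n - ⟪velocity UL, n⟫))
  linarith [pressure_pos hγ hL, pressure_lt_density_mul_sq_soundSpeed hγ hR]

theorem speedStar_lt_speedR : speedStar γ UL UR n < speedR γ UL UR n := by
  have hcL := soundSpeed_pos hγ hL
  have hSL := speedL_le_left (γ := γ) (n := n) (UL := UL) (UR := UR)
  have hSR := left_le_speedR (γ := γ) (n := n) (UL := UL) (UR := UR)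
  rw [speedStar, div_lt_iff_of_neg (speedStar_denom_neg hγ hL hR)]
  have h_speeds : soundSpeed γ UL * soundSpeed γ UL ≤ (⟪velocity UL, n⟫ - speedL γ UL UR n)
      * (speedR γ UL UR n - ⟪velocity UL, n⟫) :=
    mul_le_mul (by linarith) (by linarith) hcL.le (by linarith)
  have := mul_le_mul_of_nonneg_left h_speeds hL.1.le
  have := mul_nonneg hR.1.le (sq_nonneg (speedR γ UL UR n - ⟪velocity UR, n⟫))
  linarith [pressure_pos hγ hR, pressure_lt_density_mul_sq_soundSpeed hγ hL]

theorem starState_left_mem_G (hn : ‖n‖ = 1) :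
    starState γ UL (speedL γ UL UR n) (speedStar γ UL UR n) n ∈ G := by
  have hc := soundSpeed_pos hγ hL
  have hS := speedL_le_left (γ := γ) (n := n) (UL := UL) (UR := UR)
  refine starState_mem_G hγ hn hL ?_ (div_pos_of_neg_of_neg (by linarith)
    (sub_neg.2 (speedL_lt_speedStar hγ hL hR)))
  rw [abs_of_neg (by linarith)]
  linarith

theorem starState_right_mem_G (hn : ‖n‖ = 1) :
    starState γ UR (speedR γ UL UR n) (speedStar γ UL UR n) n ∈ G := by
  have hc := soundSpeed_pos hγ hR
  have hS := right_le_speedR (γ := γ) (n := n) (UL := UL) (UR := UR)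
  refine starState_mem_G hγ hn hR ?_ (div_pos (by linarith)
    (sub_pos.2 (speedStar_lt_speedR hγ hL hR)))
  rw [abs_of_pos (by linarith)]
  linarith

theorem starFlux_right_sub_left :
    starFlux γ UR (speedR γ UL UR n) (speedStar γ UL UR n) n
        - starFlux γ UL (speedL γ UL UR n) (speedStar γ UL UR n) n
      = speedStar γ UL UR n • (starState γ UR (speedR γ UL UR n) (speedStar γ UL UR n) n
        - starState γ UL (speedL γ UL UR n) (speedStar γ UL UR n) n) := by
  have hcL := soundSpeed_pos hγ hL
  have hcR := soundSpeed_pos hγ hR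
  have hSL := speedL_le_left (γ := γ) (n := n) (UL := UL) (UR := UR)
  have hSR := right_le_speedR (γ := γ) (n := n) (UL := UL) (UR := UR)
  rw [starFlux_eq_smul_add_pressureFlux hL.1.ne' (by linarith) (speedL_lt_speedStar hγ hL hR).ne,
    starFlux_eq_smul_add_pressureFlux hR.1.ne' (by linarith) (speedStar_lt_speedR hγ hL hR).ne',
    starPressure_left_eq_right hγ hL hR]
  module

theorem hllc_eq_flux_add_waves :
    hllc γ UL UR n = flux γ UL n
      + min (speedL γ UL UR n) 0
        • (starState γ UL (speedL γ UL UR n) (speedStar γ UL UR n) n - UL)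
      + min (speedStar γ UL UR n) 0
        • (starState γ UR (speedR γ UL UR n) (speedStar γ UL UR n) n
          - starState γ UL (speedL γ UL UR n) (speedStar γ UL UR n) n)
      + min (speedR γ UL UR n) 0
        • (UR - starState γ UR (speedR γ UL UR n) (speedStar γ UL UR n) n) := by
  have h_jump := sub_eq_iff_eq_add.1 (starFlux_right_sub_left (n := n) hγ hL hR)
  have hLs := speedL_lt_speedStar (n := n) hγ hL hR
  have hsR := speedStar_lt_speedR (n := n) hγ hL hR
  rw [hllc]
  split_ifs with hSL hSs hSR
  · simp [min_eq_right hSL, min_eq_right (hSL.trans hLs.le),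
      min_eq_right (hSL.trans (hLs.trans hsR).le)]
  · rw [min_eq_left (not_le.1 hSL).le, min_eq_right hSs, min_eq_right (hSs.trans hsR.le), starFlux]
    module
  · rw [min_eq_left (not_le.1 hSL).le, min_eq_left (not_le.1 hSs).le, min_eq_right hSR, h_jump,
      starFlux]
    module
  · rw [min_eq_left (not_le.1 hSL).le, min_eq_left (not_le.1 hSs).le, min_eq_left (not_le.1 hSR).le]
    rw [starFlux] at h_jump
    rw [eq_sub_of_add_eq h_jump, starFlux]
    module

theorem smul_add_flux_sub_hllc_mem_admissibleCone (hn : ‖n‖ = 1)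
    (hαL : alpha γ n UL ≤ α) (hαR : alpha γ n UR ≤ α) :
    α • UL + (flux γ UL n - hllc γ UL UR n) ∈ admissibleCone := by
  have hα0 : 0 ≤ α := (alpha_pos hγ n hL).le.trans hαL
  have hVL := starState_left_mem_G hγ hL hR hn
  have hVR := starState_right_mem_G hγ hL hR hn
  have hLs := min_le_min_right 0 (speedL_lt_speedStar (n := n) hγ hL hR).le
  have hsR := min_le_min_right 0 (speedStar_lt_speedR (n := n) hγ hL hR).le
  have hαL' : 0 ≤ α + min (speedL γ UL UR n) 0 :=
    neg_le_iff_add_nonneg'.1 (le_min (neg_le_speedL hαL hαR) (neg_nonpos.2 hα0))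
  rw [hllc_eq_flux_add_waves hγ hL hR]
  convert add_mem (add_mem (add_mem
      (admissibleCone.smul_mem hαL' (mem_admissibleCone_of_mem_G hL))
      (admissibleCone.smul_mem (sub_nonneg.2 hLs) (mem_admissibleCone_of_mem_G hVL)))
      (admissibleCone.smul_mem (sub_nonneg.2 hsR) (mem_admissibleCone_of_mem_G hVR)))
      (admissibleCone.smul_mem (neg_nonneg.2 (min_le_right (speedR γ UL UR n) 0))
        (mem_admissibleCone_of_mem_G hR)) using 1
  module

theorem two_mul_smul_sub_hllc_mem_G (hn : ‖n‖ = 1)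
    (hαL : alpha γ n UL ≤ α) (hαR : alpha γ n UR ≤ α) :
    (2 * α) • UL - hllc γ UL UR n ∈ G := by
  convert add_mem_G (smul_sub_flux_mem_G hγ hn hL hαL)
    (smul_add_flux_sub_hllc_mem_admissibleCone hγ hL hR hn hαL hαR) using 1
  module

end HLLC

theorem flux_zero (γ : ℝ) (U : State) : flux γ U 0 = 0 := by simp [flux]

theorem alpha_smul {c : ℝ} (hc : 0 < c) (γ : ℝ) (n : Plane) (U : State) :
    alpha γ n (c • U) = alpha γ n U := by
  have hρ : density (c • U) = c * density U := rfl
  have hm : momentum (c • U) = c • momentum U := rfl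
  have hE : energy (c • U) = c * energy U := rfl
  have h_velocity : velocity (c • U) = velocity U := by
    rw [velocity, hρ, hm, smul_smul, mul_inv, mul_right_comm, inv_mul_cancel₀ hc.ne', one_mul,
      velocity]
  have h_internal : internalEnergy (c • U) = c * internalEnergy U := by
    rw [internalEnergy, internalEnergy, hE, hm, hρ, norm_smul, Real.norm_of_nonneg hc.le]
    field_simp
  rw [alpha, h_velocity, soundSpeed, pressure, h_internal, hρ, mul_left_comm (γ - 1) c,
    mul_left_comm γ c, mul_div_mul_left _ _ hc.ne', alpha, soundSpeed, pressure]

end Euler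

section FundamentalTheorem

theorem eventually_mem_iff_of_notMem_frontier {X : Type*} [TopologicalSpace X] {s : Set X} {x : X}
    (hx : x ∉ frontier s) : ∀ᶠ y in 𝓝 x, (y ∈ s ↔ x ∈ s) := by
  by_cases hxs : x ∈ s
  · filter_upwards [mem_interior_iff_mem_nhds.1 ((mem_interior_iff_notMem_frontier hxs).2 hx)]
      with y hy using iff_of_true hy hxs
  · rw [← frontier_compl] at hx
    filter_upwards [mem_interior_iff_mem_nhds.1 ((mem_interior_iff_notMem_frontier hxs).2 hx)]
      with y hy using iff_of_false hy hxs

theorem eventually_mul_nonpos_iff {a b x : ℝ} (hx : x ≠ a) :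
    ∀ᶠ y in 𝓝 x, ((y - a) * b ≤ 0 ↔ (x - a) * b ≤ 0) := by
  rcases lt_or_gt_of_ne hx with h | h
  · filter_upwards [gt_mem_nhds h] with y hy
    simp [mul_nonpos_iff, h.le, h.not_ge, hy.le, hy.not_ge]
  · filter_upwards [lt_mem_nhds h] with y hy
    simp [mul_nonpos_iff, h.le, h.not_ge, hy.le, hy.not_ge]

variable {ι : Type*} {X : Finset ι} {t c : ι → ℝ} {S : Set ℝ}

theorem isLocallyConstant_indicator_sub_sum (ht : Set.InjOn t X)
    (hS : ∀ i ∈ X, ∀ᶠ x in 𝓝 (t i), (x ∈ S ↔ (x - t i) * c i ≤ 0))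
    (hfrontier : frontier S ⊆ t '' X) :
    IsLocallyConstant fun x => S.indicator (1 : ℝ → ℝ) x
      - ∑ i ∈ X, {y | (y - t i) * c i ≤ 0}.indicator 1 x := by
  classical
  have h_const : ∀ {s : Set ℝ} {x y : ℝ}, (y ∈ s ↔ x ∈ s) →
      s.indicator (1 : ℝ → ℝ) y = s.indicator 1 x := fun h => by
    simp only [Set.indicator_apply, h, Pi.one_apply]
  refine (IsLocallyConstant.iff_eventually_eq _).2 fun x => ?_
  have h_away : ∀ i, x ≠ t i → ∀ᶠ y in 𝓝 x, {y | (y - t i) * c i ≤ 0}.indicator (1 : ℝ → ℝ) y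
      = {y | (y - t i) * c i ≤ 0}.indicator 1 x := fun i hi =>
    (eventually_mul_nonpos_iff hi).mono fun y hy => h_const hy
  by_cases hx : x ∈ t '' X
  · obtain ⟨j, hj, rfl⟩ := hx
    have h_others : ∀ᶠ y in 𝓝 (t j), ∀ i ∈ X.erase j,
        {y | (y - t i) * c i ≤ 0}.indicator (1 : ℝ → ℝ) y
          = {y | (y - t i) * c i ≤ 0}.indicator 1 (t j) :=
      (Finset.eventually_all _).2 fun i hi => h_away i fun h =>
        Finset.ne_of_mem_erase hi (ht hj (Finset.mem_of_mem_erase hi) h).symm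
    filter_upwards [hS j hj, h_others] with y hy h_others
    have hyj : S.indicator (1 : ℝ → ℝ) y = {y | (y - t j) * c j ≤ 0}.indicator 1 y := by
      simp only [Set.indicator_apply, hy, Set.mem_ofPred_eq]
    have hjj : S.indicator (1 : ℝ → ℝ) (t j) = {y | (y - t j) * c j ≤ 0}.indicator 1 (t j) := by
      simp only [Set.indicator_apply, (hS j hj).self_of_nhds, Set.mem_ofPred_eq]
    rw [← Finset.add_sum_erase X _ hj, ← Finset.add_sum_erase X _ hj, hyj, hjj,
      Finset.sum_congr rfl h_others, sub_add_cancel_left, sub_add_cancel_left]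
  · have h_all : ∀ᶠ y in 𝓝 x, ∀ i ∈ X, {y | (y - t i) * c i ≤ 0}.indicator (1 : ℝ → ℝ) y
        = {y | (y - t i) * c i ≤ 0}.indicator 1 x :=
      (Finset.eventually_all _).2 fun i hi => h_away i fun h => hx ⟨i, hi, h.symm⟩
    filter_upwards [h_all, eventually_mem_iff_of_notMem_frontier (mt (@hfrontier x) hx)]
      with y h_all hyS
    rw [Finset.sum_congr rfl h_all, h_const hyS]

theorem indicator_eq_sum_sign_mul_indicator (hbdd : BddAbove S) (ht : Set.InjOn t X)
    (hc : ∀ i ∈ X, c i ≠ 0) (hS : ∀ i ∈ X, ∀ᶠ x in 𝓝 (t i), (x ∈ S ↔ (x - t i) * c i ≤ 0))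
    (hfrontier : frontier S ⊆ t '' X) {x : ℝ} (hx : x ∉ t '' X) :
    S.indicator (1 : ℝ → ℝ) x = ∑ i ∈ X, Real.sign (c i) * (Set.Iic (t i)).indicator 1 x := by
  obtain ⟨M, hM⟩ := hbdd
  obtain ⟨b, hMb, htb⟩ := ((Filter.eventually_gt_atTop M).and
    ((Finset.eventually_all X).2 fun i _ => Filter.eventually_gt_atTop (t i))).exists
  have hb : b ∉ S := fun h => (hM h).not_gt hMb
  have h_const :=
    (isLocallyConstant_indicator_sub_sum ht hS hfrontier).apply_eq_of_preconnectedSpace x b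
  rw [Set.indicator_of_notMem hb, zero_sub, sub_eq_iff_eq_add, neg_add_eq_sub,
    ← Finset.sum_sub_distrib] at h_const
  refine h_const.trans (Finset.sum_congr rfl fun i hi => ?_)
  have htx : x ≠ t i := fun h => hx ⟨i, hi, h.symm⟩
  have htb := htb i hi
  rcases lt_or_gt_of_ne (hc i hi) with hci | hci <;> rcases lt_or_gt_of_ne htx with hxi | hxi <;>
    simp [mul_nonpos_iff, Real.sign_of_neg, Real.sign_of_pos, hci, hci.le, hci.not_ge, hxi.le,
      hxi.not_ge, htb.le, htb.not_ge]

theorem setIntegral_deriv_eq_sum_sign_mul (hcompact : IsCompact S) (ht : Set.InjOn t X)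
    (hc : ∀ i ∈ X, c i ≠ 0) (hS : ∀ i ∈ X, ∀ᶠ x in 𝓝 (t i), (x ∈ S ↔ (x - t i) * c i ≤ 0))
    (hfrontier : frontier S ⊆ t '' X) {f f' : ℝ → ℝ}
    (hf : ∀ x, HasDerivAt f (f' x) x) (hf' : Continuous f') :
    ∫ x in S, f' x = ∑ i ∈ X, Real.sign (c i) * f (t i) := by
  classical
  have h_sum := fun {x} => indicator_eq_sum_sign_mul_indicator (x := x) hcompact.bddAbove ht hc hS
    hfrontier
  obtain ⟨m, hm⟩ := hcompact.bddBelow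
  obtain ⟨a, ham, hat⟩ := ((Filter.eventually_lt_atBot m).and
    ((Finset.eventually_all X).2 fun i _ => Filter.eventually_lt_atBot (t i))).exists
  have ha : ∀ x ∈ S, a < x := fun x hx => ham.trans_le (hm hx)
  have h_sign : ∑ i ∈ X, Real.sign (c i) = 0 := by
    rw [← Set.indicator_of_notMem (fun h => (ha a h).false) 1,
      h_sum fun ⟨i, hi, h⟩ => (hat i hi).ne' h]
    exact Finset.sum_congr rfl fun i hi => by simp [(hat i hi).le]
  have h_ae : S.indicator f' =ᵐ[volume]
      fun x => ∑ i ∈ X, Real.sign (c i) * (Set.Ioc a (t i)).indicator f' x := by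
    filter_upwards [(X.finite_toSet.image t).countable.ae_notMem volume] with x hx
    by_cases hax : a < x
    · have := congrArg (· * f' x) (h_sum hx)
      simpa only [Finset.sum_mul, mul_assoc, Set.indicator_apply, Set.mem_Ioc, hax, true_and,
        Set.mem_Iic, Pi.one_apply, ite_mul, one_mul, zero_mul] using this
    · rw [Set.indicator_of_notMem fun h => hax (ha x h)]
      exact (Finset.sum_eq_zero fun i _ => by simp [hax]).symm
  calc ∫ x in S, f' x
      = ∑ i ∈ X, Real.sign (c i) * ∫ x in Set.Ioc a (t i), f' x := by
        rw [← integral_indicator hcompact.measurableSet, integral_congr_ae h_ae,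
          integral_finsetSum]
        · simp only [integral_const_mul, integral_indicator measurableSet_Ioc]
        · exact fun i _ => ((integrable_indicator_iff measurableSet_Ioc).2
            (hf'.integrableOn_Ioc)).const_mul _
    _ = ∑ i ∈ X, Real.sign (c i) * (f (t i) - f a) := Finset.sum_congr rfl fun i hi => by
        rw [← intervalIntegral.integral_of_le (hat i hi).le,
          intervalIntegral.integral_eq_sub_of_hasDerivAt (fun x _ => hf x)
            (hf'.intervalIntegrable _ _)]
    _ = ∑ i ∈ X, Real.sign (c i) * f (t i) := by
        simp only [mul_sub, Finset.sum_sub_distrib, ← Finset.sum_mul, h_sign, zero_mul, sub_zero]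

end FundamentalTheorem

theorem continuous_evalAt (p : MvPolynomial (Fin 2) ℝ) : Continuous (evalAt p) :=
  (MvPolynomial.continuous_eval p).comp (by fun_prop)

section Slices

/-- The point of the plane with coordinate `i` equal to `z.2` and the other coordinate equal to
`z.1`: for fixed `z.1`, a parametrization of a line parallel to the `i`-th axis. -/
noncomputable def slicePoint (i : Fin 2) (z : ℝ × ℝ) : Plane :=
  WithLp.toLp 2 fun l => if l = i then z.2 else z.1

variable {i j : Fin 2} {K : Set Plane}

theorem slicePoint_apply (i : Fin 2) (z : ℝ × ℝ) (l : Fin 2) :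
    slicePoint i z l = if l = i then z.2 else z.1 := rfl

theorem slicePoint_eta (hij : i ≠ j) (z : Plane) : slicePoint i (z j, z i) = z := by
  ext l
  rw [slicePoint_apply]
  split_ifs with h
  · rw [h]
  · rw [show l = j by omega]

theorem continuous_slicePoint (i : Fin 2) : Continuous (slicePoint i) := by
  refine (PiLp.continuous_toLp 2 _).comp (continuous_pi fun l => ?_)
  split_ifs <;> fun_prop

theorem continuous_slicePoint_right (i : Fin 2) (y : ℝ) :
    Continuous fun x => slicePoint i (y, x) :=
  (continuous_slicePoint i).comp (by fun_prop)

theorem measurePreserving_slicePoint (i : Fin 2) : MeasurePreserving (slicePoint i) := by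
  have h_toLp := (PiLp.volume_preserving_toLp (Fin 2)).comp (volume_preserving_finTwoArrow ℝ).symm
  fin_cases i
  · have h_zero : slicePoint 0 =
        (WithLp.toLp 2 ∘ MeasurableEquiv.finTwoArrow.symm) ∘ Prod.swap := by
      ext z l
      fin_cases l <;> simp [slicePoint, MeasurableEquiv.finTwoArrow]
    exact h_zero ▸ h_toLp.comp
      (Measure.measurePreserving_swap (μ := (volume : Measure ℝ)) (ν := volume))
  · have h_one : slicePoint 1 = WithLp.toLp 2 ∘ MeasurableEquiv.finTwoArrow.symm := by
      ext z l
      fin_cases l <;> simp [slicePoint, MeasurableEquiv.finTwoArrow]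
    exact h_one ▸ h_toLp

theorem measurableEmbedding_slicePoint (i : Fin 2) : MeasurableEmbedding (slicePoint i) := by
  refine (continuous_slicePoint i).measurableEmbedding fun z w h => ?_
  have h_coord := fun l => congrArg (fun x : Plane => x l) h
  simp only [slicePoint_apply, Fin.forall_fin_two] at h_coord
  fin_cases i
  · exact Prod.ext h_coord.2 h_coord.1
  · exact Prod.ext h_coord.1 h_coord.2

theorem isCompact_preimage_slicePoint (hK : IsCompact K) (i : Fin 2) (y : ℝ) :
    IsCompact ((fun x => slicePoint i (y, x)) ⁻¹' K) := by
  have h_proj : IsCompact ((fun z : Plane => z i) '' K) := hK.image (by fun_prop)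
  refine h_proj.of_isClosed_subset
    (hK.isClosed.preimage (continuous_slicePoint_right i y)) fun x hx => ⟨_, hx, ?_⟩
  simp [slicePoint_apply]

theorem setIntegral_eq_integral_slices (i : Fin 2) (hK : IsCompact K) {g : Plane → ℝ}
    (hg : Continuous g) :
    ∫ x in K, g x =
      ∫ y : ℝ, ∫ x in (fun x => slicePoint i (y, x)) ⁻¹' K, g (slicePoint i (y, x)) := by
  have h_meas : MeasurableSet (slicePoint i ⁻¹' K) :=
    (continuous_slicePoint i).measurable hK.measurableSet
  have h_int : Integrable ((slicePoint i ⁻¹' K).indicator fun z => g (slicePoint i z))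
      (volume.prod volume) :=
    (integrable_indicator_iff h_meas).2 <|
      ((measurePreserving_slicePoint i).integrableOn_comp_preimage
        (measurableEmbedding_slicePoint i)).2 (hg.continuousOn.integrableOn_compact hK)
  rw [← (measurePreserving_slicePoint i).setIntegral_preimage_emb
    (measurableEmbedding_slicePoint i), ← integral_indicator h_meas]
  refine (integral_prod _ h_int).trans (integral_congr_ae (Filter.Eventually.of_forall fun y => ?_))
  exact integral_indicator (isCompact_preimage_slicePoint hK i y).measurableSet

theorem hasDerivAt_evalAt_slicePoint (p : MvPolynomial (Fin 2) ℝ) (i : Fin 2) (y x : ℝ) :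
    HasDerivAt (fun x => evalAt p (slicePoint i (y, x)))
      (evalAt (MvPolynomial.pderiv i p) (slicePoint i (y, x))) x := by
  induction p using MvPolynomial.induction_on with
  | C a => simpa [evalAt] using hasDerivAt_const x a
  | add p q hp hq =>
    simp only [evalAt, map_add] at hp hq ⊢
    exact hp.add hq
  | mul_X p l hp =>
    have h_coord : HasDerivAt (fun x => slicePoint i (y, x) l) (if l = i then 1 else 0) x := by
      simp only [slicePoint_apply]
      split_ifs
      exacts [hasDerivAt_id x, hasDerivAt_const x y]
    have h_mul := hp.mul h_coord
    simp only [evalAt, map_mul, MvPolynomial.eval_X, MvPolynomial.pderiv_mul, map_add,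
      MvPolynomial.pderiv_X, Pi.single_apply, apply_ite (MvPolynomial.eval _), map_one,
      map_zero] at h_mul ⊢
    exact h_mul

end Slices

section Edges

variable {K : Set Plane} {a b n : Plane} {i j : Fin 2} {y : ℝ}

theorem IsOutwardNormal.inner_sub_eq_zero (h : IsOutwardNormal K a b n)
    (hK : openSegment ℝ a b ⊆ K) : ⟪b - a, n⟫ = 0 := by
  have h_mem : ∀ s ∈ Set.Ioo (0 : ℝ) 1, a + s • (b - a) ∈ openSegment ℝ a b :=
    fun s hs => openSegment_eq_image' ℝ a b ▸ Set.mem_image_of_mem _ hs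
  have h_half : (1 / 2 : ℝ) ∈ Set.Ioo (0 : ℝ) 1 := by norm_num
  have h_max : IsLocalMax (fun s : ℝ => ⟪a + s • (b - a), n⟫) (1 / 2) := by
    have h_cont : ContinuousAt (fun s : ℝ => a + s • (b - a)) (1 / 2) := by fun_prop
    filter_upwards [h_cont.eventually (h.2 _ (h_mem _ h_half)), isOpen_Ioo.mem_nhds h_half]
      with s hs hs01
    simpa only [inner_sub_left, sub_nonpos] using hs.1 (hK (h_mem s hs01))
  have h_deriv : HasDerivAt (fun s : ℝ => ⟪a + s • (b - a), n⟫) ⟪b - a, n⟫ (1 / 2) := by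
    simp only [inner_add_left, real_inner_smul_left]
    simpa using ((hasDerivAt_id (1 / 2 : ℝ)).mul_const ⟪b - a, n⟫).const_add ⟪a, n⟫
  exact h_max.hasDerivAt_eq_zero h_deriv

theorem norm_mul_abs_apply_of_inner_eq_zero {v : Plane} (hn : ‖n‖ = 1) (h : ⟪v, n⟫ = 0)
    (hij : i ≠ j) : ‖v‖ * |n i| = |v j| := by
  have h_norm_sq : ∀ w : Plane, ‖w‖ ^ 2 = w i ^ 2 + w j ^ 2 := fun w => by
    rw [EuclideanSpace.real_norm_sq_eq, Fin.sum_univ_two]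
    fin_cases i <;> fin_cases j <;> simp [add_comm] at hij ⊢
  have h_inner : v i * n i + v j * n j = 0 := by
    rw [← h, PiLp.inner_apply, Fin.sum_univ_two]
    fin_cases i <;> fin_cases j <;> simp [mul_comm, add_comm] at hij ⊢
  have h_unit := hn ▸ h_norm_sq n
  rw [← abs_norm v, ← abs_mul, ← sq_eq_sq_iff_abs_eq_abs, mul_pow, h_norm_sq v]
  linear_combination (v i * n i - v j * n j) * h_inner - v j ^ 2 * h_unit

/-- The point of the line through `a` and `b` whose coordinate `j` is `y`; a junk value if
`a j = b j`. -/
noncomputable def crossing (a b : Plane) (j : Fin 2) (y : ℝ) : Plane :=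
  a + ((y - a j) / (b j - a j)) • (b - a)

theorem crossing_apply_self (hab : a j ≠ b j) : crossing a b j y j = y := by
  have := sub_ne_zero.2 hab.symm
  simp only [crossing, PiLp.add_apply, PiLp.smul_apply, PiLp.sub_apply, smul_eq_mul]
  field_simp
  ring

theorem slicePoint_crossing (hij : i ≠ j) (hab : a j ≠ b j) :
    slicePoint i (y, crossing a b j y i) = crossing a b j y := by
  simpa only [crossing_apply_self hab] using slicePoint_eta hij (crossing a b j y)

theorem uIoo_eq_image {a b : ℝ} (hab : a ≠ b) :
    Set.uIoo a b = (fun s => a + s * (b - a)) '' Set.Ioo 0 1 :=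
  (openSegment_eq_Ioo' hab).symm.trans (openSegment_eq_image' ℝ a b)

theorem crossing_mem_openSegment (hy : y ∈ Set.uIoo (a j) (b j)) :
    crossing a b j y ∈ openSegment ℝ a b := by
  have hab : a j ≠ b j := Set.nonempty_uIoo.1 ⟨y, hy⟩
  obtain ⟨s, hs, rfl⟩ := uIoo_eq_image hab ▸ hy
  rw [crossing, add_sub_cancel_left, mul_div_cancel_right₀ _ (sub_ne_zero.2 hab.symm),
    openSegment_eq_image']
  exact Set.mem_image_of_mem _ hs

theorem eq_crossing_of_mem_segment {z : Plane} (hz : z ∈ segment ℝ a b) (ha : z j ≠ a j)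
    (hb : z j ≠ b j) : z j ∈ Set.uIoo (a j) (b j) ∧ z = crossing a b j (z j) := by
  have hz' : z ∈ openSegment ℝ a b :=
    mem_openSegment_of_ne_left_right (fun h => ha (h ▸ rfl)) (fun h => hb (h ▸ rfl)) hz
  rw [openSegment_eq_image'] at hz'
  obtain ⟨s, hs, rfl⟩ := hz'
  simp only [PiLp.add_apply, PiLp.smul_apply, PiLp.sub_apply, smul_eq_mul] at ha ⊢
  have hab : a j ≠ b j := fun h => ha (by rw [h, sub_self, mul_zero, add_zero])
  refine ⟨uIoo_eq_image hab ▸ Set.mem_image_of_mem _ hs, ?_⟩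
  rw [crossing, add_sub_cancel_left, mul_div_cancel_right₀ _ (sub_ne_zero.2 hab.symm)]

theorem setIntegral_uIoo_comp_sub_div (a b : ℝ) (g : ℝ → ℝ) :
    ∫ y in Set.uIoo a b, g ((y - a) / (b - a)) = |b - a| * ∫ s in (0 : ℝ)..1, g s := by
  rcases eq_or_ne a b with rfl | hab
  · simp
  have h_ne : b - a ≠ 0 := sub_ne_zero.2 hab.symm
  have h_deriv : ∀ s ∈ Set.Ioo (0 : ℝ) 1,
      HasDerivWithinAt (fun s => a + s * (b - a)) (b - a) (Set.Ioo 0 1) s := fun s _ => by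
    simpa using (((hasDerivAt_id s).mul_const (b - a)).const_add a).hasDerivWithinAt
  have h_inj : Set.InjOn (fun s => a + s * (b - a)) (Set.Ioo 0 1) :=
    fun s _ t _ h => mul_right_cancel₀ h_ne (add_left_cancel h)
  rw [uIoo_eq_image hab, integral_image_eq_integral_abs_deriv_smul measurableSet_Ioo h_deriv h_inj,
    intervalIntegral.integral_of_le zero_le_one, integral_Ioc_eq_integral_Ioo]
  simp only [add_sub_cancel_left, mul_div_cancel_right₀ _ h_ne, smul_eq_mul, integral_const_mul]

theorem IsOutwardNormal.eventually_slicePoint_mem_iff (h : IsOutwardNormal K a b n) (hij : i ≠ j)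
    {z : Plane} (hz : z ∈ openSegment ℝ a b) :
    ∀ᶠ x in 𝓝 (z i), slicePoint i (z j, x) ∈ K ↔ (x - z i) * n i ≤ 0 := by
  have h_inner : ∀ x, ⟪slicePoint i (z j, x) - z, n⟫ = (x - z i) * n i := fun x => by
    have : slicePoint i (z j, x) - z = EuclideanSpace.single i (x - z i) := by
      conv_lhs => rw [← slicePoint_eta hij z]
      ext l
      simp only [PiLp.sub_apply, slicePoint_apply, PiLp.single_apply, hij.symm, if_false]
      split_ifs <;> simp
    rw [this, EuclideanSpace.inner_single_left, conj_trivial]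
  have h_nhds := h.2 z hz
  rw [← slicePoint_eta hij z] at h_nhds
  filter_upwards [(continuous_slicePoint_right i (z j)).continuousAt.eventually h_nhds] with x hx
  rw [hx, slicePoint_eta hij, h_inner]

end Edges

namespace PolygonalMesh

variable {Ω : Set Plane} {C E : Type*} (T : PolygonalMesh Ω C E) {K : C} {e : E} {i j : Fin 2}
  {y : ℝ}

theorem segment_subset_frontier_cell (he : e ∈ T.edges K) :
    segment ℝ (T.src e) (T.tgt e) ⊆ frontier (T.cell K) := by
  rw [T.frontier_cell]
  exact Set.subset_biUnion_of_mem (u := fun e => segment ℝ (T.src e) (T.tgt e)) he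

theorem inner_tgt_sub_src_normal (he : e ∈ T.edges K) :
    ⟪T.tgt e - T.src e, T.normal K e⟫ = 0 :=
  (T.isOutwardNormal K e he).inner_sub_eq_zero <| (openSegment_subset_segment ℝ _ _).trans <|
    (T.segment_subset_frontier_cell he).trans (T.isCompact_cell K).isClosed.frontier_subset

theorem edgeLength_mul_abs_normal (he : e ∈ T.edges K) (hij : i ≠ j) :
    T.edgeLength e * |T.normal K e i| = |T.tgt e j - T.src e j| := by
  rw [edgeLength, dist_comm, dist_eq_norm, norm_mul_abs_apply_of_inner_eq_zero
    (T.isOutwardNormal K e he).1 (T.inner_tgt_sub_src_normal he) hij, PiLp.sub_apply]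

theorem normal_apply_ne_zero (he : e ∈ T.edges K) (hij : i ≠ j) (h : T.src e j ≠ T.tgt e j) :
    T.normal K e i ≠ 0 := fun h_zero =>
  sub_ne_zero.2 h.symm (abs_eq_zero.1 (by
    rw [← T.edgeLength_mul_abs_normal he hij, h_zero, abs_zero, mul_zero]))

theorem injOn_crossing_apply (hij : i ≠ j) (y : ℝ) :
    Set.InjOn (fun e => crossing (T.src e) (T.tgt e) j y i)
      {e | y ∈ Set.uIoo (T.src e j) (T.tgt e j)} := by
  intro e he e' he' h
  have h_eq : crossing (T.src e) (T.tgt e) j y = crossing (T.src e') (T.tgt e') j y := by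
    rw [← slicePoint_crossing hij (Set.nonempty_uIoo.1 ⟨y, he⟩),
      ← slicePoint_crossing hij (Set.nonempty_uIoo.1 ⟨y, he'⟩)]
    exact congrArg (fun x => slicePoint i (y, x)) h
  by_contra h_ne
  exact Set.disjoint_left.1 (T.disjoint_edges e e' h_ne) (crossing_mem_openSegment he)
    (h_eq ▸ openSegment_subset_segment ℝ _ _ (crossing_mem_openSegment he'))

open scoped Classical in
/-- The edges of `K` that the line `x_j = y` meets in a relatively interior point and
transversally. -/
noncomputable def crossedEdges (K : C) (j : Fin 2) (y : ℝ) : Finset E :=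
  {e ∈ T.edges K | y ∈ Set.uIoo (T.src e j) (T.tgt e j)}

theorem mem_crossedEdges :
    e ∈ T.crossedEdges K j y ↔ e ∈ T.edges K ∧ y ∈ Set.uIoo (T.src e j) (T.tgt e j) := by
  classical exact Finset.mem_filter

theorem frontier_preimage_slicePoint_subset (hij : i ≠ j)
    (hy : ∀ e ∈ T.edges K, y ≠ T.src e j ∧ y ≠ T.tgt e j) :
    frontier ((fun x => slicePoint i (y, x)) ⁻¹' T.cell K) ⊆
      (fun e => crossing (T.src e) (T.tgt e) j y i) '' T.crossedEdges K j y := by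
  intro x hx
  have h_frontier := (continuous_slicePoint_right i y).frontier_preimage_subset _ hx
  rw [Set.mem_preimage, T.frontier_cell] at h_frontier
  obtain ⟨e, he, hxe⟩ := Set.mem_iUnion₂.1 h_frontier
  have hj : slicePoint i (y, x) j = y := if_neg hij.symm
  obtain ⟨h_mem, h_eq⟩ := eq_crossing_of_mem_segment (j := j) hxe
    (hj.symm ▸ (hy e he).1) (hj.symm ▸ (hy e he).2)
  rw [hj] at h_mem h_eq
  refine ⟨e, T.mem_crossedEdges.2 ⟨he, h_mem⟩, ?_⟩
  simp only [← h_eq, slicePoint_apply, if_true]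

theorem setIntegral_slice_pderiv (p : MvPolynomial (Fin 2) ℝ) (hij : i ≠ j)
    (hy : ∀ e ∈ T.edges K, y ≠ T.src e j ∧ y ≠ T.tgt e j) :
    ∫ x in (fun x => slicePoint i (y, x)) ⁻¹' T.cell K,
        evalAt (MvPolynomial.pderiv i p) (slicePoint i (y, x)) =
      ∑ e ∈ T.crossedEdges K j y,
        Real.sign (T.normal K e i) * evalAt p (crossing (T.src e) (T.tgt e) j y) := by
  have h_ne : ∀ e ∈ T.crossedEdges K j y, T.src e j ≠ T.tgt e j :=
    fun e he => Set.nonempty_uIoo.1 ⟨y, (T.mem_crossedEdges.1 he).2⟩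
  rw [setIntegral_deriv_eq_sum_sign_mul (X := T.crossedEdges K j y)
    (t := fun e => crossing (T.src e) (T.tgt e) j y i) (c := fun e => T.normal K e i)
    (isCompact_preimage_slicePoint (T.isCompact_cell K) i y)
    ((T.injOn_crossing_apply hij y).mono fun e he => (T.mem_crossedEdges.1 he).2)
    (fun e he => T.normal_apply_ne_zero (T.mem_crossedEdges.1 he).1 hij (h_ne e he)) ?_
    (T.frontier_preimage_slicePoint_subset hij hy)
    (hasDerivAt_evalAt_slicePoint p i y)
    ((continuous_evalAt _).comp (continuous_slicePoint_right i y))]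
  · exact Finset.sum_congr rfl fun e he => by rw [slicePoint_crossing hij (h_ne e he)]
  · intro e he
    have h_nhds := (T.isOutwardNormal K e (T.mem_crossedEdges.1 he).1).eventually_slicePoint_mem_iff
      hij (crossing_mem_openSegment (T.mem_crossedEdges.1 he).2)
    rwa [crossing_apply_self (h_ne e he)] at h_nhds

theorem setIntegral_pderiv (K : C) (p : MvPolynomial (Fin 2) ℝ) (i : Fin 2) :
    ∫ x in T.cell K, evalAt (MvPolynomial.pderiv i p) x =
      ∑ e ∈ T.edges K, T.edgeLength e * T.normal K e i *
        ∫ s in (0 : ℝ)..1, evalAt p (T.src e + s • (T.tgt e - T.src e)) := by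
  classical
  obtain ⟨j, hji⟩ := exists_ne i
  have hij := hji.symm
  have h_generic : ∀ᵐ y : ℝ, ∀ e ∈ T.edges K, y ≠ T.src e j ∧ y ≠ T.tgt e j :=
    (Finset.eventually_all _).2 fun e _ =>
      (Measure.ae_ne volume _).and (Measure.ae_ne volume _)
  have h_slice : ∀ᵐ y : ℝ, ∫ x in (fun x => slicePoint i (y, x)) ⁻¹' T.cell K,
      evalAt (MvPolynomial.pderiv i p) (slicePoint i (y, x)) =
        ∑ e ∈ T.edges K, (Set.uIoo (T.src e j) (T.tgt e j)).indicator
          (fun y => Real.sign (T.normal K e i) * evalAt p (crossing (T.src e) (T.tgt e) j y)) y :=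
    h_generic.mono fun y hy => by
      simp only [T.setIntegral_slice_pderiv p hij hy, crossedEdges, Finset.sum_filter,
        Set.indicator_apply]
  have h_meas (e : E) : MeasurableSet (Set.uIoo (T.src e j) (T.tgt e j)) := measurableSet_Ioo
  rw [setIntegral_eq_integral_slices i (T.isCompact_cell K) (continuous_evalAt _),
    integral_congr_ae h_slice, integral_finsetSum]
  · refine Finset.sum_congr rfl fun e he => ?_
    rw [integral_indicator (h_meas e), integral_const_mul]
    simp only [crossing]
    rw [setIntegral_uIoo_comp_sub_div _ _
      fun s => evalAt p (T.src e + s • (T.tgt e - T.src e)),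
      ← T.edgeLength_mul_abs_normal he hij, ← mul_assoc, mul_left_comm]
    rcases lt_trichotomy (T.normal K e i) 0 with h | h | h
    · simp [Real.sign_of_neg h, abs_of_neg h]
    · simp [h]
    · simp [Real.sign_of_pos h, abs_of_pos h]
  · refine fun e _ => (integrable_indicator_iff (h_meas e)).2
      (Continuous.integrableOn_Icc ?_ |>.mono_set Set.Ioo_subset_Icc_self)
    exact continuous_const.mul ((continuous_evalAt p).comp (by unfold crossing; fun_prop))

end PolygonalMesh

namespace GaussRule

variable {N : ℕ} (g : GaussRule N)

-- The rule is exact for the square of the polynomial vanishing at all the other nodes.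
theorem weight_pos (μ : Fin N) : 0 < g.weight μ := by
  set r := Lagrange.nodal (Finset.univ.erase μ) g.node with hr
  have h_natDegree : (r ^ 2).natDegree < 2 * N := by
    rw [Polynomial.natDegree_pow, hr, Lagrange.natDegree_nodal, Finset.card_erase_of_mem (by simp),
      Finset.card_univ, Fintype.card_fin]
    have := μ.pos
    omega
  have h_single : ∑ ν, g.weight ν * (r ^ 2).eval (g.node ν) =
      g.weight μ * (r ^ 2).eval (g.node μ) :=
    Finset.sum_eq_single_of_mem μ (Finset.mem_univ μ) fun ν _ hν => by
      rw [Polynomial.eval_pow, hr, Lagrange.eval_nodal_at_node (by simpa using hν)]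
      simp
  have h_sq_nonneg (s : ℝ) : 0 ≤ (r ^ 2).eval s := by
    rw [Polynomial.eval_pow]
    positivity
  obtain ⟨s, hs, hrs⟩ : ∃ s ∈ Set.Icc (0 : ℝ) 1, ¬ r.IsRoot s := by
    by_contra! h
    exact (Lagrange.nodal_monic : r.Monic).ne_zero
      (Polynomial.eq_zero_of_infinite_isRoot r ((Set.Icc_infinite zero_lt_one).mono h))
  have h_integral : 0 < ∫ s in (0 : ℝ)..1, (r ^ 2).eval s := by
    refine intervalIntegral.integral_pos zero_lt_one (r ^ 2).continuous.continuousOn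
      (fun s _ => h_sq_nonneg s) ⟨s, hs, ?_⟩
    rw [Polynomial.eval_pow]
    exact sq_pos_of_ne_zero hrs
  rw [← g.exact _ h_natDegree, h_single] at h_integral
  exact pos_of_mul_pos_left h_integral (h_sq_nonneg _)

end GaussRule

theorem exists_natDegree_le_eval_eq_evalAt (p : MvPolynomial (Fin 2) ℝ) (a v : Plane) :
    ∃ r : Polynomial ℝ, r.natDegree ≤ p.totalDegree ∧ ∀ s, r.eval s = evalAt p (a + s • v) := by
  set c : Fin 2 → Polynomial ℝ :=
    fun i => Polynomial.C (a i) + Polynomial.X * Polynomial.C (v i) with hc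
  have h_natDegree (i : Fin 2) : (c i).natDegree ≤ 1 := by
    simp only [hc]
    compute_degree
  refine ⟨MvPolynomial.aeval c p, ?_, fun s => ?_⟩
  · simpa using MvPolynomial.aeval_natDegree_le p le_rfl c h_natDegree
  · rw [← Polynomial.coe_evalRingHom, MvPolynomial.aeval_def, MvPolynomial.hom_eval₂, evalAt,
      MvPolynomial.eval]
    congr 1
    · ext; simp
    · funext i; simpa [hc] using mul_comm _ _

theorem GaussRule.sum_weight_mul_evalAt {N : ℕ} (g : GaussRule N) {p : MvPolynomial (Fin 2) ℝ}
    (hp : p.totalDegree < 2 * N) (a v : Plane) :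
    ∑ μ, g.weight μ * evalAt p (a + g.node μ • v) =
      ∫ s in (0 : ℝ)..1, evalAt p (a + s • v) := by
  obtain ⟨r, hr_degree, hr⟩ := exists_natDegree_le_eval_eq_evalAt p a v
  simpa only [hr] using g.exact r (hr_degree.trans_lt hp)

theorem totalDegree_pderiv_le {σ R : Type*} [CommSemiring R] (p : MvPolynomial σ R) (i : σ) :
    (MvPolynomial.pderiv i p).totalDegree ≤ p.totalDegree := by
  classical
  conv_lhs => rw [p.as_sum, map_sum]
  refine (MvPolynomial.totalDegree_finsetSum _ _).trans (Finset.sup_le fun m hm => ?_)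
  rw [MvPolynomial.pderiv_monomial]
  calc _ ≤ (m - Finsupp.single i 1).sum fun _ => id := MvPolynomial.totalDegree_monomial_le _ _
    _ ≤ m.sum fun _ => id :=
        Finsupp.sum_le_sum_index tsub_le_self (fun _ _ => monotone_id) fun _ _ => rfl
    _ ≤ p.totalDegree := MvPolynomial.le_totalDegree hm

theorem gradAt_apply (p : MvPolynomial (Fin 2) ℝ) (x : Plane) (i : Fin 2) :
    gradAt p x i = evalAt (MvPolynomial.pderiv i p) x := by
  fin_cases i <;> rfl

theorem evalAt_one (x : Plane) : evalAt 1 x = 1 := map_one _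

theorem gradAt_one (x : Plane) : gradAt 1 x = 0 := by
  ext i
  simp [gradAt_apply, evalAt]

section Averages

variable {Ω : Set Plane} {C E : Type*} {T : PolygonalMesh Ω C E} {k : ℕ} {K : C}

theorem DGSpace.totalDegree_le (u : DGSpace C k) (K : C) :
    (u K : MvPolynomial (Fin 2) ℝ).totalDegree ≤ k :=
  (MvPolynomial.mem_restrictTotalDegree (Fin 2) k _).1 (u K).2

theorem DGState.avg_eq_sum {ι : Type*} {s : Finset ι} {w : ι → ℝ} {x : ι → Plane}
    (h : ∀ u : DGSpace C k, u.avg T K = ∑ i ∈ s, w i * u.val K (x i)) (U : DGState C k) :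
    U.avg T K = ∑ i ∈ s, w i • U.val K (x i) := by
  refine Prod.ext ?_ (Prod.ext ?_ ?_)
  · simp [DGState.avg, DGState.val, h, Prod.fst_sum]
  · ext l
    rw [Prod.snd_sum, Prod.fst_sum]
    fin_cases l <;> simp [DGState.avg, DGState.val, h]
  · simp [DGState.avg, DGState.val, h, Prod.snd_sum]

namespace PolygonalMesh

variable (T)

theorem nonempty_interior_cell (K : C) : (interior (T.cell K)).Nonempty :=
  (T.isConnected_interior K).nonempty

theorem measure_cell_ne_zero (K : C) : volume (T.cell K) ≠ 0 :=
  (Measure.measure_pos_of_nonempty_interior volume (T.nonempty_interior_cell K)).ne'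

theorem measure_cell_ne_top (K : C) : volume (T.cell K) ≠ ⊤ := (T.isCompact_cell K).measure_ne_top

theorem area_pos (K : C) : 0 < T.area K :=
  ENNReal.toReal_pos (T.measure_cell_ne_zero K) (T.measure_cell_ne_top K)

theorem edgeLength_pos (e : E) : 0 < T.edgeLength e := dist_pos.2 (T.src_ne_tgt e)

theorem edges_nonempty (K : C) : (T.edges K).Nonempty := by
  by_contra h
  have h_frontier : frontier (T.cell K) = ∅ := by
    rw [T.frontier_cell, Finset.not_nonempty_iff_eq_empty.1 h]
    simp
  rcases isClopen_iff.1 (isClopen_iff_frontier_eq_empty.2 h_frontier) with h_cell | h_cell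
  · simpa [h_cell] using T.nonempty_interior_cell K
  · exact noncompact_univ Plane (h_cell ▸ T.isCompact_cell K)

theorem mem_edges_of_neighbour_eq_some {K' : C} {e : E} (h : T.neighbour K e = some K') :
    e ∈ T.edges K' := by
  unfold neighbour at h
  split_ifs at h with h_exists
  exact Option.some.inj h ▸ h_exists.choose_spec.2

end PolygonalMesh

namespace CellQuadrature

variable (q : CellQuadrature (T.cell K) k)

theorem sum_weight : ∑ i, q.weight i = 1 := by
  simpa [evalAt_one, setAverage_const (T.measure_cell_ne_zero K) (T.measure_cell_ne_top K)]
    using q.exact 1 (by simp)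

theorem avg_eq_sum (u : DGSpace C k) : u.avg T K = ∑ i, q.weight i * u.val K (q.node i) :=
  (q.exact _ (u.totalDegree_le K)).symm

theorem avg_mem_of_convex {A : Set ℝ} (hA : Convex ℝ A) {u : DGSpace C k}
    (hu : ∀ i, u.val K (q.node i) ∈ A) : u.avg T K ∈ A := by
  rw [q.avg_eq_sum]
  exact hA.sum_mem (fun i _ => q.weight_nonneg i) q.sum_weight fun i _ => hu i

theorem avg_state_mem_of_convex {A : Set State} (hA : Convex ℝ A) {U : DGState C k}
    (hU : ∀ i, U.val K (q.node i) ∈ A) : U.avg T K ∈ A := by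
  rw [DGState.avg_eq_sum q.avg_eq_sum]
  exact hA.sum_mem (fun i _ => q.weight_nonneg i) q.sum_weight fun i _ => hU i

theorem area_smul_sum_gradAt {N : ℕ} (g : GaussRule N) {p : MvPolynomial (Fin 2) ℝ}
    (hp : p.totalDegree ≤ k) (hN : p.totalDegree < 2 * N) :
    T.area K • ∑ i, q.weight i • gradAt p (q.node i) =
      ∑ e ∈ T.edges K,
        (T.edgeLength e * ∑ μ, g.weight μ * evalAt p (T.gaussPoint g e μ)) • T.normal K e := by
  ext l
  simp only [PiLp.smul_apply, WithLp.ofLp_sum, Finset.sum_apply, smul_eq_mul, gradAt_apply]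
  rw [q.exact _ ((totalDegree_pderiv_le p l).trans hp), setAverage_eq, smul_eq_mul,
    T.setIntegral_pderiv, ← PolygonalMesh.area, mul_inv_cancel_left₀ (T.area_pos K).ne']
  refine Finset.sum_congr rfl fun e _ => ?_
  simp only [PolygonalMesh.gaussPoint]
  rw [g.sum_weight_mul_evalAt hN, mul_right_comm]

end CellQuadrature

theorem PolygonalMesh.SpecialQuadrature.avg_eq_sum {N : ℕ} {g : GaussRule N}
    (Q : T.SpecialQuadrature g k K) (U : DGState C k) :
    U.avg T K = ∑ e ∈ T.edges K, ∑ μ, Q.edgeWeight e μ • U.val K (T.gaussPoint g e μ) +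
      ∑ i, Q.weight i • U.val K (Q.node i) := by
  have h_avg (u : DGSpace C k) : u.avg T K =
      ∑ i ∈ (T.edges K ×ˢ Finset.univ).disjSum Finset.univ,
        Sum.elim (fun i => Q.edgeWeight i.1 i.2) Q.weight i *
          u.val K (Sum.elim (fun i => T.gaussPoint g i.1 i.2) Q.node i) := by
    rw [Finset.sum_disjSum, Finset.sum_product]
    exact (Q.exact _ (u.totalDegree_le K)).symm
  rw [DGState.avg_eq_sum h_avg, Finset.sum_disjSum, Finset.sum_product]
  rfl

end Averages

namespace WBScheme

open Euler

variable {Ω : Set Plane} {C E : Type*} {T : PolygonalMesh Ω C E} {k : ℕ} (S : WBScheme T k)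
  (U : DGState C k) (UBdry : E → Fin (k + 1) → State) (K : C)

section CellAverageEvolution

/-- The edge sum of the jumps `[p_h^e]` weighted by the outward normals, which appears in
`α̃_K^{S,2}`. -/
noncomputable def jumpSum (K : C) : Plane :=
  ∑ e ∈ T.edges K, (T.edgeLength e * ∑ μ, S.gauss.weight μ * S.peJump K e μ) • T.normal K e

/-- The contribution of the source terms to `L_K(U_h)`: the weighted accelerations of the states at
the quadrature nodes by `∇p_h^e / ρ_h^e`, and that of the cell average by the pressure jumps. -/
noncomputable def sourceRate (K : C) : State :=
  ∑ q, (S.quad K).weight q • accelerate (U.val K ((S.quad K).node q))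
      ((S.ρe.val K ((S.quad K).node q))⁻¹ • S.pe.grad K ((S.quad K).node q))
    + accelerate (U.avg T K) ((2 * T.area K * S.ρe.avg T K)⁻¹ • S.jumpSum K)

/-- The outflow of the numerical fluxes through the edges of `K`, per unit area. -/
noncomputable def fluxRate (K : C) : State :=
  ∑ e ∈ T.edges K, ∑ μ,
    (T.edgeLength e * S.gauss.weight μ / T.area K) • S.numFlux U UBdry K e μ

theorem area_smul_sum_grad_pe :
    T.area K • ∑ q, (S.quad K).weight q • S.pe.grad K ((S.quad K).node q) =
      ∑ e ∈ T.edges K,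
        (T.edgeLength e * ∑ μ, S.gauss.weight μ * S.peInt K e μ) • T.normal K e :=
  have h_degree := S.pe.totalDegree_le K
  (S.quad K).area_smul_sum_gradAt S.gauss h_degree (by omega)

-- `p^{e,⋆} = p^{e,int} + ½ [p^e]`, and the interior traces are absorbed by the divergence theorem.
theorem sourceBracket_one :
    S.sourceBracket K 1 =
      T.area K • ∑ q, (S.quad K).weight q • S.pe.grad K ((S.quad K).node q)
        + (2⁻¹ : ℝ) • S.jumpSum K := by
  rw [area_smul_sum_grad_pe, jumpSum, Finset.smul_sum, ← Finset.sum_add_distrib, sourceBracket]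
  simp only [evalAt_one, gradAt_one, smul_zero, Finset.sum_const_zero, sub_zero, mul_one]
  refine Finset.sum_congr rfl fun e _ => ?_
  have h_star : ∑ μ, S.gauss.weight μ * S.peStar K e μ =
      ∑ μ, S.gauss.weight μ * S.peInt K e μ + 2⁻¹ * ∑ μ, S.gauss.weight μ * S.peJump K e μ := by
    rw [Finset.mul_sum, ← Finset.sum_add_distrib]
    refine Finset.sum_congr rfl fun μ _ => ?_
    rw [peStar, peJump]
    ring
  rw [← Finset.sum_smul, h_star]
  module

theorem sourceMomentum_one :
    S.sourceMomentum U K 1 =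
      T.area K • ∑ q, (S.quad K).weight q • density (U.val K ((S.quad K).node q)) •
          (S.ρe.val K ((S.quad K).node q))⁻¹ • S.pe.grad K ((S.quad K).node q)
        + density (U.avg T K) • (2 * S.ρe.avg T K)⁻¹ • S.jumpSum K := by
  set r := density (U.avg T K) / S.ρe.avg T K with hr
  have h_sum : ∑ q, ((S.quad K).weight q *
      (density (U.val K ((S.quad K).node q)) / S.ρe.val K ((S.quad K).node q) - r)) •
        S.pe.grad K ((S.quad K).node q) =
      ∑ q, (S.quad K).weight q • density (U.val K ((S.quad K).node q)) •
          (S.ρe.val K ((S.quad K).node q))⁻¹ • S.pe.grad K ((S.quad K).node q)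
        - r • ∑ q, (S.quad K).weight q • S.pe.grad K ((S.quad K).node q) := by
    rw [Finset.smul_sum, ← Finset.sum_sub_distrib]
    refine Finset.sum_congr rfl fun q _ => ?_
    rw [div_eq_mul_inv]
    module
  simp only [sourceMomentum, sourceBracket_one, evalAt_one, mul_one, ← hr, h_sum]
  rw [hr, div_eq_mul_inv, mul_inv]
  module

theorem sourceEnergy_one :
    S.sourceEnergy U K 1 =
      T.area K * ∑ q, (S.quad K).weight q * ⟪momentum (U.val K ((S.quad K).node q)),
          (S.ρe.val K ((S.quad K).node q))⁻¹ • S.pe.grad K ((S.quad K).node q)⟫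
        + ⟪momentum (U.avg T K), (2 * S.ρe.avg T K)⁻¹ • S.jumpSum K⟫ := by
  set w := (S.ρe.avg T K)⁻¹ • momentum (U.avg T K) with hw
  have h_sum : ∑ q, (S.quad K).weight q *
      ⟪(S.ρe.val K ((S.quad K).node q))⁻¹ • momentum (U.val K ((S.quad K).node q)) - w,
        S.pe.grad K ((S.quad K).node q)⟫ =
      ∑ q, (S.quad K).weight q * ⟪momentum (U.val K ((S.quad K).node q)),
          (S.ρe.val K ((S.quad K).node q))⁻¹ • S.pe.grad K ((S.quad K).node q)⟫
        - ⟪w, ∑ q, (S.quad K).weight q • S.pe.grad K ((S.quad K).node q)⟫ := by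
    simp only [inner_sub_left, real_inner_smul_left, real_inner_smul_right, inner_sum, mul_sub,
      Finset.sum_sub_distrib]
  simp only [sourceEnergy, sourceBracket_one, evalAt_one, mul_one, ← hw, h_sum, inner_add_right,
    real_inner_smul_right]
  rw [hw, real_inner_smul_left _ (S.jumpSum K), mul_inv]
  ring

theorem source_one :
    ((0, S.sourceMomentum U K 1, S.sourceEnergy U K 1) : State) =
      T.area K • S.sourceRate U K := by
  have h_area := (T.area_pos K).ne'
  have h_cancel : (2 * S.ρe.avg T K)⁻¹ = T.area K * (2 * T.area K * S.ρe.avg T K)⁻¹ := by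
    rw [mul_right_comm 2, mul_inv _ (T.area K), mul_left_comm, mul_inv_cancel₀ h_area, mul_one]
  rw [sourceMomentum_one, sourceEnergy_one, sourceRate, smul_add, h_cancel, mul_smul]
  refine Prod.ext ?_ (Prod.ext ?_ ?_)
  · simp [accelerate, Prod.fst_sum]
  · simp [accelerate, Prod.fst_sum, Prod.snd_sum, smul_comm (T.area K)]
  · simp [accelerate, Prod.snd_sum, real_inner_smul_right]

theorem L_eq_sourceRate_sub_fluxRate :
    S.L U UBdry K = S.sourceRate U K - S.fluxRate U UBdry K := by
  have h_area := (T.area_pos K).ne'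
  rw [L, rhs, source_one]
  simp only [gradAt_one, flux_zero, smul_zero, Finset.sum_const_zero, zero_add, evalAt_one,
    mul_one, smul_sub, smul_smul, inv_mul_cancel₀ h_area, one_smul, Finset.smul_sum, fluxRate,
    div_eq_inv_mul]

end CellAverageEvolution

section Bounds

variable {K} {e : E} {μ : Fin (k + 1)}

/-- The states and the equilibrium pressures that enter the numerical fluxes on the edges of `K`
are physically admissible. -/
structure HasAdmissibleTraces (K : C) : Prop where
  peInt_pos : ∀ e ∈ T.edges K, ∀ μ, 0 < S.peInt K e μ
  peExt_pos : ∀ e ∈ T.edges K, ∀ μ, 0 < S.peExt K e μ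
  UInt_mem_G : ∀ e ∈ T.edges K, ∀ μ, S.UInt U K e μ ∈ G
  UExt_mem_G : ∀ e ∈ T.edges K, ∀ μ, S.UExt U UBdry K e μ ∈ G

theorem alpha_UInt_le_alphaF (he : e ∈ T.edges K) (μ : Fin (k + 1)) :
    alpha S.γ (T.normal K e) (S.UInt U K e μ) ≤ S.alphaF U UBdry K :=
  (le_ciSup (f := fun i : T.edges K × Fin (k + 1) =>
    alpha S.γ (T.normal K i.1) (S.UInt U K i.1 i.2)) (Set.finite_range _).bddAbove
    (⟨e, he⟩, μ)).trans (le_max_left _ _)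

theorem alpha_UExt_le_alphaF (he : e ∈ T.edges K) (μ : Fin (k + 1)) :
    alpha S.γ (T.normal K e) (S.UExt U UBdry K e μ) ≤ S.alphaF U UBdry K :=
  (le_ciSup (f := fun i : T.edges K × Fin (k + 1) =>
    alpha S.γ (T.normal K i.1) (S.UExt U UBdry K i.1 i.2)) (Set.finite_range _).bddAbove
    (⟨e, he⟩, μ)).trans (le_max_right _ _)

variable {S U UBdry}

theorem alphaF_pos (hγ : 1 < S.γ) (he : e ∈ T.edges K) (hU : S.UInt U K e μ ∈ G) :
    0 < S.alphaF U UBdry K :=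
  (alpha_pos hγ _ hU).trans_le (S.alpha_UInt_le_alphaF U UBdry he μ)

theorem peStar_pos (h_int : 0 < S.peInt K e μ) (h_ext : 0 < S.peExt K e μ) :
    0 < S.peStar K e μ :=
  half_pos (add_pos h_int h_ext)

theorem alphaS1_smul_avg_add_mem_admissibleCone
    (hρe : ∀ q, 0 < S.ρe.val K ((S.quad K).node q))
    (hU : ∀ q, U.val K ((S.quad K).node q) ∈ G) :
    S.alphaS1 U K • U.avg T K
      + ∑ q, (S.quad K).weight q • accelerate (U.val K ((S.quad K).node q))
        ((S.ρe.val K ((S.quad K).node q))⁻¹ • S.pe.grad K ((S.quad K).node q))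
      ∈ admissibleCone := by
  rw [DGState.avg_eq_sum (S.quad K).avg_eq_sum, Finset.smul_sum, ← Finset.sum_add_distrib]
  refine sum_mem fun q _ => ?_
  rw [smul_comm, ← smul_add]
  refine admissibleCone.smul_mem ((S.quad K).weight_nonneg q)
    (smul_add_accelerate_mem_admissibleCone (hU q) ?_)
  rw [norm_smul, norm_inv, Real.norm_of_nonneg (hρe q).le, inv_mul_eq_div, div_div]
  exact le_ciSup (f := fun q => ‖S.pe.grad K ((S.quad K).node q)‖ /
    (S.ρe.val K ((S.quad K).node q) * √(2 * specificEnergy (U.val K ((S.quad K).node q)))))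
    (Set.finite_range _).bddAbove q

theorem alphaS2_smul_avg_add_mem_admissibleCone (hρe : 0 < S.ρe.avg T K) (hU : U.avg T K ∈ G) :
    S.alphaS2 U K • U.avg T K
      + accelerate (U.avg T K) ((2 * T.area K * S.ρe.avg T K)⁻¹ • S.jumpSum K)
      ∈ admissibleCone := by
  refine smul_add_accelerate_mem_admissibleCone hU ?_
  have h_area := T.area_pos K
  rw [norm_smul, norm_inv, Real.norm_of_nonneg (by positivity), inv_mul_eq_div, div_div]
  rfl

theorem alphaS_smul_avg_add_sourceRate_mem_admissibleCone
    (hρe : ∀ q, 0 < S.ρe.val K ((S.quad K).node q))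
    (hU : ∀ q, U.val K ((S.quad K).node q) ∈ G) :
    S.alphaS U K • U.avg T K + S.sourceRate U K ∈ admissibleCone := by
  rw [alphaS, sourceRate, add_smul, add_add_add_comm]
  exact add_mem (alphaS1_smul_avg_add_mem_admissibleCone hρe hU)
    (alphaS2_smul_avg_add_mem_admissibleCone ((S.quad K).avg_mem_of_convex (convex_Ioi 0) hρe)
      ((S.quad K).avg_state_mem_of_convex convex_G hU))

theorem smul_UInt_sub_smul_numFlux_mem_G (hγ : 1 < S.γ)
    (h_traces : S.HasAdmissibleTraces U UBdry K) (he : e ∈ T.edges K) {κ w : ℝ} (hκ : 0 < κ)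
    (hw : κ * (2 * S.alphaF U UBdry K * (S.peStar K e μ / S.peInt K e μ)) ≤ w) :
    w • S.UInt U K e μ - κ • S.numFlux U UBdry K e μ ∈ G := by
  have h_int := h_traces.peInt_pos e he μ
  have h_ext := h_traces.peExt_pos e he μ
  have hUInt := h_traces.UInt_mem_G e he μ
  have hUExt := h_traces.UExt_mem_G e he μ
  have h_scale_int := div_pos (peStar_pos h_int h_ext) h_int
  have h_scale_ext := div_pos (peStar_pos h_int h_ext) h_ext
  have h_flux : (2 * S.alphaF U UBdry K) • (S.peStar K e μ / S.peInt K e μ) • S.UInt U K e μ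
      - S.numFlux U UBdry K e μ ∈ G := by
    refine two_mul_smul_sub_hllc_mem_G hγ (smul_mem_G h_scale_int hUInt)
      (smul_mem_G h_scale_ext hUExt) (T.isOutwardNormal K e he).1 ?_ ?_
    · rw [alpha_smul h_scale_int]
      exact S.alpha_UInt_le_alphaF U UBdry he μ
    · rw [alpha_smul h_scale_ext]
      exact S.alpha_UExt_le_alphaF U UBdry he μ
  have h_rest := admissibleCone.smul_mem (sub_nonneg.2 hw) (mem_admissibleCone_of_mem_G hUInt)
  convert add_mem_G (smul_mem_G hκ h_flux) h_rest using 1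
  module

theorem smul_avg_sub_smul_fluxRate_mem_G (hγ : 1 < S.γ) (Q : T.SpecialQuadrature S.gauss k K)
    (h_traces : S.HasAdmissibleTraces U UBdry K) (h_node : ∀ q, U.val K (Q.node q) ∈ G)
    {c Δt : ℝ} (hΔt : 0 < Δt)
    (hCFL : ∀ e ∈ T.edges K, ∀ μ, Δt * (S.alphaF U UBdry K *
        (2 * T.edgeLength e * S.peStar K e μ / (T.area K * S.peInt K e μ)))
      ≤ c * (Q.edgeWeight e μ / S.gauss.weight μ)) :
    c • U.avg T K - Δt • S.fluxRate U UBdry K ∈ G := by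
  have hc : 0 < c := by
    obtain ⟨e, he⟩ := T.edges_nonempty K
    have h_area := T.area_pos K
    have h_length := T.edgeLength_pos e
    have h_int := h_traces.peInt_pos e he 0
    have h_star := peStar_pos h_int (h_traces.peExt_pos e he 0)
    have h_alpha := alphaF_pos (UBdry := UBdry) hγ he (h_traces.UInt_mem_G e he 0)
    refine pos_of_mul_pos_left (lt_of_lt_of_le ?_ (hCFL e he 0))
      (div_pos (Q.edgeWeight_pos e he 0) (S.gauss.weight_pos 0)).le
    positivity
  have h_gauss (e : E) (he : e ∈ T.edges K) (μ : Fin (k + 1)) :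
      (c * Q.edgeWeight e μ) • S.UInt U K e μ -
        (Δt * (T.edgeLength e * S.gauss.weight μ / T.area K)) • S.numFlux U UBdry K e μ ∈ G := by
    have h_area := T.area_pos K
    have h_length := T.edgeLength_pos e
    have h_weight := S.gauss.weight_pos μ
    refine smul_UInt_sub_smul_numFlux_mem_G hγ h_traces he (by positivity) ?_
    have h_cfl := hCFL e he μ
    rw [← mul_div_assoc c, le_div_iff₀ h_weight] at h_cfl
    refine Eq.trans_le ?_ h_cfl
    field_simp
  have h_edges : ∑ e ∈ T.edges K, ∑ μ, ((c * Q.edgeWeight e μ) • S.UInt U K e μ -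
      (Δt * (T.edgeLength e * S.gauss.weight μ / T.area K)) • S.numFlux U UBdry K e μ) ∈ G :=
    sum_mem_G (T.edges_nonempty K) fun e he =>
      sum_mem_G Finset.univ_nonempty fun μ _ => h_gauss e he μ
  have h_interior : ∑ q, (c * Q.weight q) • U.val K (Q.node q) ∈ admissibleCone :=
    sum_mem fun q _ => mem_admissibleCone_of_mem_G
      (smul_mem_G (mul_pos hc (Q.weight_pos q)) (h_node q))
  convert add_mem_G h_edges h_interior using 1
  simp only [Q.avg_eq_sum, fluxRate, UInt, Finset.sum_sub_distrib, smul_add, Finset.smul_sum,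
    smul_smul]
  abel

end Bounds

section Traces

variable {S U UBdry} {Q : ∀ K, T.SpecialQuadrature S.gauss k K}

theorem gaussPoint_mem_pointSet {e : E} (he : e ∈ T.edges K) (μ : Fin (k + 1)) :
    T.gaussPoint S.gauss e μ ∈ S.pointSet (Q K) :=
  Or.inl (Or.inl ⟨e, he, μ, rfl⟩)

theorem specialQuadrature_node_mem_pointSet (q : Fin (Q K).size) :
    (Q K).node q ∈ S.pointSet (Q K) :=
  Or.inl (Or.inr ⟨q, rfl⟩)

theorem quad_node_mem_pointSet (q : Fin (S.quad K).size) :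
    (S.quad K).node q ∈ S.pointSet (Q K) :=
  Or.inr ⟨q, rfl⟩

theorem hasAdmissibleTraces_of_pointSet
    (hpe : ∀ K, ∀ x ∈ S.pointSet (Q K), 0 < S.pe.val K x)
    (hU : ∀ K, ∀ x ∈ S.pointSet (Q K), U.val K x ∈ G)
    (hBdry : ∀ e ∈ T.edges K, T.neighbour K e = none →
      ∀ μ, 0 < S.peBdry e μ ∧ UBdry e μ ∈ G) :
    S.HasAdmissibleTraces U UBdry K where
  peInt_pos e he μ := hpe K _ (gaussPoint_mem_pointSet K he μ)
  UInt_mem_G e he μ := hU K _ (gaussPoint_mem_pointSet K he μ)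
  peExt_pos e he μ := by
    unfold peExt
    cases h : T.neighbour K e with
    | none => exact (hBdry e he h μ).1
    | some K' =>
      exact hpe K' _ (gaussPoint_mem_pointSet K' (T.mem_edges_of_neighbour_eq_some h) μ)
  UExt_mem_G e he μ := by
    unfold UExt
    cases h : T.neighbour K e with
    | none => exact (hBdry e he h μ).2
    | some K' =>
      exact hU K' _ (gaussPoint_mem_pointSet K' (T.mem_edges_of_neighbour_eq_some h) μ)

end Traces

end WBScheme

theorem mainTheorem2_general {Ω : Set Plane} {C E : Type*} {T : PolygonalMesh Ω C E} {k : ℕ}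
    {S : WBScheme T k} (hγ : 1 < S.γ) {K : C} (Q : T.SpecialQuadrature S.gauss k K)
    {U : DGState C k} {UBdry : E → Fin (k + 1) → State}
    (hρe : ∀ q, 0 < S.ρe.val K ((S.quad K).node q))
    (hU_quad : ∀ q, U.val K ((S.quad K).node q) ∈ Euler.G)
    (hU_node : ∀ q, U.val K (Q.node q) ∈ Euler.G)
    (h_traces : S.HasAdmissibleTraces U UBdry K)
    {Δt : ℝ} (hΔt : 0 < Δt)
    (hCFL : ∀ e ∈ T.edges K, ∀ μ,
      Δt * (S.alphaF U UBdry K *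
            (2 * T.edgeLength e * S.peStar K e μ / (T.area K * S.peInt K e μ))
          + S.alphaS U K * (Q.edgeWeight e μ / S.gauss.weight μ))
        ≤ Q.edgeWeight e μ / S.gauss.weight μ) :
    U.avg T K + Δt • S.L U UBdry K ∈ Euler.G := by
  have h_flux : (1 - Δt * S.alphaS U K) • U.avg T K - Δt • S.fluxRate U UBdry K ∈ Euler.G :=
    WBScheme.smul_avg_sub_smul_fluxRate_mem_G hγ Q h_traces hU_node hΔt
      fun e he μ => by linarith [hCFL e he μ]
  have h_source : Δt • (S.alphaS U K • U.avg T K + S.sourceRate U K) ∈ Euler.admissibleCone :=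
    Euler.admissibleCone.smul_mem hΔt.le
      (WBScheme.alphaS_smul_avg_add_sourceRate_mem_admissibleCone hρe hU_quad)
  convert Euler.add_mem_G h_flux h_source using 1
  rw [S.L_eq_sourceRate_sub_fluxRate]
  module

theorem mainTheorem2 {Ω : Set Plane} {C E : Type*} (T : PolygonalMesh Ω C E) (k : ℕ)
    -- the target hydrostatic equilibrium and its projection onto the DG space
    (φ ρ p : Plane → ℝ) (hydrostatic : Euler.IsHydrostatic Ω φ ρ p)
    (P : (Plane → ℝ) → DGSpace C k) (hP : T.IsProjection P)
    -- the scheme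
    (S : WBScheme T k) (hγ : 1 < S.γ) (hρe : S.ρe = P ρ) (hpe : S.pe = P p)
    -- the special quadrature
    (Q : ∀ K, T.SpecialQuadrature S.gauss k K)
    -- the numerical solution, and its exterior states on boundary edges
    (U : DGState C k) (UBdry : E → Fin (k + 1) → State)
    (hequil : ∀ K, ∀ x ∈ S.pointSet (Q K), 0 < S.ρe.val K x ∧ 0 < S.pe.val K x)
    (hU : ∀ K, ∀ x ∈ S.pointSet (Q K), U.val K x ∈ Euler.G)
    (hBdry : ∀ K, ∀ e ∈ T.edges K, T.neighbour K e = none →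
      ∀ μ, 0 < S.peBdry e μ ∧ UBdry e μ ∈ Euler.G)
    (Δt : ℝ) (hΔt : 0 < Δt)
    (hCFL : ∀ K, ∀ e ∈ T.edges K, ∀ μ,
      Δt * (S.alphaF U UBdry K *
            (2 * T.edgeLength e * S.peStar K e μ / (T.area K * S.peInt K e μ))
          + S.alphaS U K * ((Q K).edgeWeight e μ / S.gauss.weight μ))
        ≤ (Q K).edgeWeight e μ / S.gauss.weight μ) :
    ∀ K, U.avg T K + Δt • S.L U UBdry K ∈ Euler.G := by
  intro K
  have h_traces : S.HasAdmissibleTraces U UBdry K :=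
    WBScheme.hasAdmissibleTraces_of_pointSet K (fun K x hx => (hequil K x hx).2) hU (hBdry K)
  exact mainTheorem2_general hγ (Q K)
    (fun q => (hequil K _ (WBScheme.quad_node_mem_pointSet K q)).1)
    (fun q => hU K _ (WBScheme.quad_node_mem_pointSet K q))
    (fun q => hU K _ (WBScheme.specialQuadrature_node_mem_pointSet K q)) h_traces hΔt (hCFL K)
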